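/- **Setting.** There are $n$ bidders (in a fixed order) and a finite set $G$ of $d=ks$ goods, divided into $k$ types with $s$ copies of each; copies of the same type are identical (for $g,g'$ of the same type and $S\not\ni g,g'$, $v_i(S\cup\{g\})=v_i(S\cup\{g'\})$ for every bidder $i$). Each bidder $i$ has a valuation $v_i:2^G\to[0,1]$. For prices $p\in\mathbb R_{\ge0}^G$ let $p(S)=\sum_{g\in S}p_g$ and let $\omega_i(p)$ be the set of bundles maximizing $v_i(S)-p(S)$. Each $v_i$ satisfies the gross substitutes condition: if $p\le p'$ (coordinatewise), $S\in\omega_i(p)$, $S'\subseteq S$ and $p'_g=p_g$ for all $g\in S'$, then $S'\subseteq S^*$ for some $S^*\in\omega_i(p')$. Let $\mathrm{OPT}$ be the maximum of $\sum_i v_i(S_i)$ over pairwise disjoint bundles $S_1,\dots,S_n\subseteq G$. Throughout, $\log$ is the logarithm to a fixed base $B\in(1,e]$ (e.g. $2$ or $e$). **Counter.** $\mathbf{Counter}(\varepsilon',\tau)$ reads a stream $\sigma(1),\sigma(2),\dots\in\{0,1\}$ and outputs at time $t$ the running maximum $\max_{0\le u\le t}\mathcal B(u)$ of the Binary Mechanism,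 where $\mathcal B(0)=0$ and $\mathcal B(u)=\sum_{i}\big(\sum_{w=r_i-2^i+1}^{r_i}\sigma(w)+z(r_i)\big)$; here $i$ ranges over the positions of the nonzero bits of $u$, $r_i=2^i\lfloor u/2^i\rfloor$, and $z(1),z(2),\dots$ are independent Laplace variables of scale $\log(\tau)/\varepsilon'$. **Algorithm $\mathbf{PAlloc}(\alpha,\rho,\varepsilon)$** (with failure parameter $\gamma$). Put $T=\frac{10}{\alpha\rho}$, $\varepsilon'=\frac{\varepsilon}{2T}$, $E=\frac{2\sqrt2}{\varepsilon'}(\log nT)^{5/2}\log\frac{4k}{\gamma}+1$, $m=2E+1$. Run $k+1$ independent counters $\mathbf{Counter}(\varepsilon',nT)$, numbered $0,1,\dots,k$; let $c_j$ be the current output of counter $j$. Initially all prices $p_j$ are $0$ and all bundles $g(i)$ are empty. In a round, the bidders $i$ take turns in order. In her turn, bidder $i$ first drops every $g\in g(i)$ of type $j$ with $c_j-d_{i,g}\ge s-m$ (she has been outbid), where $d_{i,g}$ is the value of $c_j$ when she last bid on $g$. If $g(i)\ne G$, she then takes an arbitrary $\omega^*$ that maximizes $v_i(\omega)-p(\omega\setminus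 g(i))$ over $\omega\supsetneq g(i)$ (each good priced at the price of its type). If $v_i(\omega^*)-p(\omega^*\setminus g(i))\ge v_i(g(i))$, she picks an arbitrary $h\in\omega^*\setminus g(i)$, of type $j$ say, records $d_{i,h}:=c_j$, adds $h$ to $g(i)$, and bids on type $j$: $1$ is fed to counter $j$ and $0$ to the other counters $1,\dots,k$. Otherwise $0$ is fed to each of the counters $1,\dots,k$. After each feed, every type $j$ with $c_j\ge(p_j/\alpha+1)(s-m)$ has its price $p_j$ raised by $\alpha$. At the end of the round each bidder in order drops the goods for which she has been outbid and feeds counter $0$ with $1$ if she wants to continue bidding, i.e. if $v_i(\omega)-p(\omega\setminus g(i))\ge v_i(g(i))$ for some $\omega\supsetneq g(i)$, and with $0$ otherwise. The algorithm halts if counter $0$ increased by less than $\rho d-2E$ in this round, and in any case after $\lceil T\rceil$ rounds. Its output is the price vector $p$ and the allocation $g$. **Theorem.** Let $\gamma,\varepsilon>0$, $d\ge n$, $0<\alpha<n/d$, and let $$E'=\frac{360\sqrt2}{\alpha^2\varepsilon}\Big(\log\frac{90n}{\alpha^2}\Big)^{5/2}\log\frac{4k}{\gamma}+1,\qquad s\ge\frac{12E'+3}{\alpha}.$$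 Then with probability at least $1-\gamma$ over the noise, whatever the arbitrary choices, the allocation $g$ computed by $\mathbf{PAlloc}(\alpha/3,\alpha/3,\varepsilon)$ hands out at most $s$ copies of each type in total and satisfies $$\sum_{i=1}^n v_i(g(i))\ \ge\ \mathrm{OPT}-\alpha d .$$ Moreover $\frac{12E'+3}{\alpha}=O\big(\frac1{\alpha^3\varepsilon}\,\mathrm{polylog}(n,k,\frac1\alpha,\frac1\gamma)\big)$: there is an exponent $c$ such that for every $\varepsilon_0>0$ there is $C>0$ with $$\frac{12E'+3}{\alpha}\le\frac{C}{\alpha^3\varepsilon}\Big(1+\ln n+\ln k+\ln\frac1\alpha+\ln\frac1\gamma\Big)^c$$ for all integers $n,k\ge1$ and all $\alpha,\gamma\in(0,1]$, $\varepsilon\in(0,\varepsilon_0]$. -/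

import Mathlib

open MeasureTheory ProbabilityTheory

noncomputable section

/-- Total price of a bundle. -/
def bundlePrice {G : Type*} (p : G → ℝ) (S : Finset G) : ℝ := ∑ g ∈ S, p g

/-- Quasi-linear utility of a bundle at given prices. -/
def utility {G : Type*} (v : Finset G → ℝ) (p : G → ℝ) (S : Finset G) : ℝ :=
  v S - bundlePrice p S

/-- The most demanded bundles at prices `p`. -/
def demand {G : Type*} (v : Finset G → ℝ) (p : G → ℝ) : Set (Finset G) :=
  {S | ∀ S', utility v p S' ≤ utility v p S}

/-- The gross substitutes condition (price vectors are nonnegative). -/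
def GrossSubstitutes {G : Type*} (v : Finset G → ℝ) : Prop :=
  ∀ p p' : G → ℝ, (∀ g, 0 ≤ p g) → (∀ g, p g ≤ p' g) →
    ∀ S ∈ demand v p, ∀ S' ⊆ S, (∀ g ∈ S', p' g = p g) →
      ∃ S₁ ∈ demand v p', S' ⊆ S₁

/-- A market with `n` bidders, goods `G`, and `k` types of goods: `val i` is the valuation of
bidder `i`, `kind g` is the type of the good `g`, and `supply` is the number of copies of each
type. -/
structure Market (n k : ℕ) (G : Type*) where
  val : Fin n → Finset G → ℝ
  kind : G → Fin k
  supply : ℕ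

open scoped Classical in
/-- Each type has exactly `supply` copies, goods of the same type are identical for all bidders,
and valuations take values in `[0, 1]`. -/
structure Market.IsValid {n k : ℕ} {G : Type*} [Fintype G] (M : Market n k G) : Prop where
  card_kind : ∀ j, (Finset.univ.filter fun g => M.kind g = j).card = M.supply
  identical : ∀ g g', M.kind g = M.kind g' → ∀ (i : Fin n) (S : Finset G), g ∉ S → g' ∉ S →
    M.val i (insert g S) = M.val i (insert g' S)
  val_mem : ∀ i S, M.val i S ∈ Set.Icc (0 : ℝ) 1

/-- Social welfare of an assignment of bundles to bidders. -/
def Market.welfare {n k : ℕ} {G : Type*} (M : Market n k G) (S : Fin n → Finset G) : ℝ :=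
  ∑ i, M.val i (S i)

/-- The optimal welfare: the maximum of the welfare over all families of pairwise disjoint
bundles. -/
def Market.opt {n k : ℕ} {G : Type*} (M : Market n k G) : ℝ :=
  sSup {w | ∃ S : Fin n → Finset G, (∀ i j, i ≠ j → Disjoint (S i) (S j)) ∧ w = M.welfare S}

open scoped Classical in
/-- In total, at most `supply` copies of each type are handed out. (Since copies of the same type
are identical, the labels of the copies can then be chosen so that the bundles are disjoint.) -/
def Market.RespectsSupply {n k : ℕ} {G : Type*} (M : Market n k G) (S : Fin n → Finset G) :
    Prop :=
  ∀ j, ∑ i, ((S i).filter fun g => M.kind g = j).card ≤ M.supply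

/-- The Laplace distribution with scale `b` (variance `2 b ^ 2`), given by its density. -/
def laplace (b : ℝ) : Measure ℝ :=
  volume.withDensity fun x => ENNReal.ofReal (Real.exp (-|x| / b) / (2 * b))

/-- The Binary Mechanism. The count at time `t` is the sum over the nonzero bits `i` of `t` of
noisy partial sums over the dyadic block of length `2 ^ i` that ends at `r = 2 ^ i * (t / 2 ^ i)`.
Each time `r` is the end of exactly one block that is created at time `r`, and `z r` is the noise
added to the partial sum over this block. The stream `σ` is indexed from `1`. -/
def binaryMechanism (z : ℕ → ℝ) (σ : ℕ → ℝ) (t : ℕ) : ℝ :=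
  ∑ i ∈ (Finset.range t.size).filter (fun i => t.testBit i = true),
    (∑ u ∈ Finset.Ioc (2 ^ i * (t / 2 ^ i) - 2 ^ i) (2 ^ i * (t / 2 ^ i)), σ u
      + z (2 ^ i * (t / 2 ^ i)))

/-- The monotone streaming counter: the running maximum of the Binary Mechanism, from the initial
value `0`. -/
def counter (z : ℕ → ℝ) (σ : ℕ → ℝ) (t : ℕ) : ℝ :=
  (Finset.range (t + 1)).sup' Finset.nonempty_range_add_one (binaryMechanism z σ)

/-- Parameters of the auction: price increment `α`, stopping fraction `ρ`, privacy parameter `ε`,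
failure probability `γ`, and the base of `log`. -/
structure PAllocParams where
  incr : ℝ
  rho : ℝ
  eps : ℝ
  gamma : ℝ
  base : ℝ

namespace PAllocParams

/-- `T = 10 / (α ρ)`. -/
def T (P : PAllocParams) : ℝ := 10 / (P.incr * P.rho)

/-- `ε' = ε / (2 T)`. -/
def eps' (P : PAllocParams) : ℝ := P.eps / (2 * P.T)

/-- The error bound `E` for `n` bidders and `k` types of goods. -/
def E (P : PAllocParams) (n k : ℕ) : ℝ :=
  2 * √2 / P.eps' * Real.logb P.base (n * P.T) ^ (5 / 2 : ℝ) * Real.logb P.base (4 * k / P.gamma)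
    + 1

/-- The reserved supply `m = 2 E + 1`. -/
def reserve (P : PAllocParams) (n k : ℕ) : ℝ := 2 * P.E n k + 1

/-- Scale of the Laplace noise in a counter with privacy parameter `ε'` and horizon `n T`. -/
def noiseScale (P : PAllocParams) (n : ℕ) : ℝ := Real.logb P.base (n * P.T) / P.eps'

end PAllocParams

/-- State of the auction. `bundle i` is the current bundle of bidder `i`, `mark i g` is the count
of the type of `g` when `i` last bid on `g`, `level j` is the number of price increments of type
`j`, `clock` is the number of bid vectors processed, `bids j` is the stream fed to `counter(j)`,
`repClock` and `reports` are the same for `counter(0)`. Streams are indexed from `1`. -/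
structure AuctionState (n k : ℕ) (G : Type*) where
  bundle : Fin n → Finset G
  mark : Fin n → G → ℝ
  level : Fin k → ℕ
  clock : ℕ
  bids : Fin k → ℕ → ℝ
  repClock : ℕ
  reports : ℕ → ℝ
  halted : Prop

namespace PAlloc

variable {n k : ℕ} {G : Type*}

def init : AuctionState n k G where
  bundle _ := ∅
  mark _ _ := 0
  level _ := 0
  clock := 0
  bids _ _ := 0
  repClock := 0
  reports _ := 0
  halted := False

/-- Current price `p` of a good: the price of its type. -/
def price (M : Market n k G) (P : PAllocParams) (st : AuctionState n k G) (g : G) : ℝ :=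
  P.incr * st.level (M.kind g)

/-- Current value `c_j` of the counter of type `j`; `z (some j)` is its noise. -/
def count (z : Option (Fin k) → ℕ → ℝ) (st : AuctionState n k G) (j : Fin k) : ℝ :=
  counter (z (some j)) (st.bids j) st.clock

/-- Current value of `counter(0)`. -/
def count0 (z : Option (Fin k) → ℕ → ℝ) (st : AuctionState n k G) : ℝ :=
  counter (z none) st.reports st.repClock

/-- The effective supply `s - m` used by the auction. -/
def effSupply (M : Market n k G) (P : PAllocParams) : ℝ := M.supply - P.reserve n k

/-- Value of moving from the bundle `S`, with the goods in it already paid for, to the bundle `W`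
(up to the sunk cost of `S`). -/
def extValue [DecidableEq G] (v : Finset G → ℝ) (p : G → ℝ) (S W : Finset G) : ℝ :=
  v W - bundlePrice p (W \ S)

/-- The best strictly larger bundles. -/
def bestExtensions [DecidableEq G] (v : Finset G → ℝ) (p : G → ℝ) (S : Finset G) :
    Set (Finset G) :=
  {W | S ⊂ W ∧ ∀ W', S ⊂ W' → extValue v p S W' ≤ extValue v p S W}

/-- A bidder holding `S` wants to bid: some strictly larger bundle is at least as good. -/
def WantsToBid [DecidableEq G] (v : Finset G → ℝ) (p : G → ℝ) (S : Finset G) : Prop :=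
  ∃ W, S ⊂ W ∧ v S ≤ extValue v p S W

/-- A way of making the arbitrary choices. In a state in which bidder `i` is about to bid, it
returns a best strictly larger bundle and a new good of that bundle. -/
structure ChoiceRule [Fintype G] [DecidableEq G] (M : Market n k G) (P : PAllocParams) where
  pick : AuctionState n k G → Fin n → Finset G × G
  pick_best : ∀ st i, st.bundle i ≠ Finset.univ →
    (pick st i).1 ∈ bestExtensions (M.val i) (price M P st) (st.bundle i)
  pick_good : ∀ st i, st.bundle i ≠ Finset.univ →
    (pick st i).2 ∈ (pick st i).1 \ st.bundle i

open scoped Classical in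
/-- Bidder `i` drops the goods for which she has been outbid: those whose count has grown by at
least `s - m` since she bid on them. -/
def dropOutbid (M : Market n k G) (P : PAllocParams) (z : Option (Fin k) → ℕ → ℝ)
    (st : AuctionState n k G) (i : Fin n) : AuctionState n k G :=
  { st with
    bundle := Function.update st.bundle i
      ((st.bundle i).filter fun g =>
        ¬ effSupply M P ≤ count z st (M.kind g) - st.mark i g) }

open scoped Classical in
/-- `Bid`: feed the unit vector of a type (or the zero vector, for `none`) to the counters, and
raise the price of every type whose count has reached the next multiple of `s - m`. -/
def bid (M : Market n k G) (P : PAllocParams) (z : Option (Fin k) → ℕ → ℝ)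
    (st : AuctionState n k G) (b : Option (Fin k)) : AuctionState n k G :=
  let st₁ : AuctionState n k G :=
    { st with
      clock := st.clock + 1
      bids := fun j => Function.update (st.bids j) (st.clock + 1) (if b = some j then 1 else 0) }
  { st₁ with
    level := fun j =>
      if (st.level j + 1) * effSupply M P ≤ count z st₁ j then st.level j + 1 else st.level j }

open scoped Classical in
/-- The turn of bidder `i` in `Propose`. -/
def turn [Fintype G] [DecidableEq G] (M : Market n k G) (P : PAllocParams)
    (z : Option (Fin k) → ℕ → ℝ) (ch : ChoiceRule M P)
    (st : AuctionState n k G) (i : Fin n) : AuctionState n k G :=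
  let st₁ := dropOutbid M P z st i
  let S := st₁.bundle i
  let W := (ch.pick st₁ i).1
  let g := (ch.pick st₁ i).2
  if S ≠ Finset.univ ∧ M.val i S ≤ extValue (M.val i) (price M P st₁) S W then
    bid M P z
      { st₁ with
        bundle := Function.update st₁.bundle i (insert g S)
        mark := Function.update st₁.mark i
          (Function.update (st₁.mark i) g (count z st₁ (M.kind g))) }
      (some (M.kind g))
  else bid M P z st₁ none

/-- `Propose`: all bidders take their turns in the fixed order. -/
def propose [Fintype G] [DecidableEq G] (M : Market n k G) (P : PAllocParams)
    (z : Option (Fin k) → ℕ → ℝ) (ch : ChoiceRule M P) (st : AuctionState n k G) :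
    AuctionState n k G :=
  (List.finRange n).foldl (turn M P z ch) st

open scoped Classical in
/-- Bidder `i` drops outbid goods and reports to `counter(0)` whether she wants to continue
bidding. -/
def report (M : Market n k G) (P : PAllocParams)
    (z : Option (Fin k) → ℕ → ℝ) (st : AuctionState n k G) (i : Fin n) : AuctionState n k G :=
  let st₁ := dropOutbid M P z st i
  { st₁ with
    repClock := st.repClock + 1
    reports := Function.update st.reports (st.repClock + 1)
      (if WantsToBid (M.val i) (price M P st₁) (st₁.bundle i) then 1 else 0) }

/-- `CountUnsatisfied`, without the halting test. -/
def countUnsatisfied (M : Market n k G) (P : PAllocParams)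
    (z : Option (Fin k) → ℕ → ℝ) (st : AuctionState n k G) : AuctionState n k G :=
  (List.finRange n).foldl (report M P z) st

/-- One round: `Propose`, `CountUnsatisfied`, and the test whether to halt, which holds if
`counter(0)` has increased by less than `ρ d - 2 E`, where `d` is the number of goods. -/
def round [Fintype G] [DecidableEq G] (M : Market n k G) (P : PAllocParams)
    (z : Option (Fin k) → ℕ → ℝ) (ch : ChoiceRule M P) (st : AuctionState n k G) :
    AuctionState n k G :=
  let st₁ := countUnsatisfied M P z (propose M P z ch st)
  { st₁ with
    halted := count0 z st₁ - count0 z st < P.rho * (Fintype.card G : ℝ) - 2 * P.E n k }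

open scoped Classical in
/-- The state after at most `r` rounds. -/
def run [Fintype G] [DecidableEq G] (M : Market n k G) (P : PAllocParams)
    (z : Option (Fin k) → ℕ → ℝ) (ch : ChoiceRule M P) : ℕ → AuctionState n k G
  | 0 => init
  | r + 1 => if (run M P z ch r).halted then run M P z ch r else round M P z ch (run M P z ch r)

end PAlloc

/-- The auction `PAlloc`: at most `T` (rounded up) rounds; the output consists of the prices of the
types and the allocation. -/
def palloc {n k : ℕ} {G : Type*} [Fintype G] [DecidableEq G] (M : Market n k G)
    (P : PAllocParams) (z : Option (Fin k) → ℕ → ℝ) (ch : PAlloc.ChoiceRule M P) :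
    (Fin k → ℝ) × (Fin n → Finset G) :=
  let st := PAlloc.run M P z ch ⌈P.T⌉₊
  (fun j => P.incr * st.level j, st.bundle)

/-- The explicit error bound `E'` of the welfare guarantee, with `log` to base `B`. -/
def supplyError (B α γ ε : ℝ) (n k : ℕ) : ℝ :=
  360 * √2 / (α ^ 2 * ε) * Real.logb B (90 * n / α ^ 2) ^ (5 / 2 : ℝ)
    * Real.logb B (4 * k / γ) + 1

end

noncomputable section

/-! ### The binary mechanism and the monotone counter -/

/-! Noise and auction separate. The Binary Mechanism outputs the exact count plus a noise term that
depends on the time but not on the stream (`binaryMechanism_eq`). So although bids react to earlier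
outputs, one event makes all counters accurate up to `E - 1`, whatever the choices
(`exists_accurate_event`, `noise_union_bound`). On that event the analysis is deterministic
(`palloc_guarantee`).

Write `D` for the effective supply `s - m` and `a` for the price increment. Three invariants carry
the analysis. A price is `a` times the floor of count over `D`. Held copies are injectively indexed
by their position in the bid sequence of their type; up to the counter error the latest `D` bids are
all still held, and after a halt no older ones are. Finally, each bundle is part of one demanded at
the prices its owner faces (`DemandInv`): outbidding and price raises only affect goods not held
afterwards, which is exactly what gross substitutes allows.

Termination: nobody bids above price 1, so bids are limited (`totalBids_le`). A bidder reports that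
she wants to continue only if she bid in this round or lost a good just before reporting; hence
goods held plus reports are at most twice the bids, while every round without a halt forces many
reports (`halted_run`).

Welfare: at the halt fewer than `ρ d` bidders want to continue, each costing at most 1; every other
bidder holds a demanded bundle (`value_le_of_inv`). Summing against any disjoint family leaves the
difference between the price of the whole supply and the payments. Copies were bought within one
increment of the current price, and a type of positive price has at most `4 E + 1 ≤ a s` copies
unsold; each effect costs at most `a s` per type. With `a = ρ = α / 3` the three losses add up to `α
d` (`welfare_le_of_settled`). -/

/-- The noise contained in the output of the Binary Mechanism at time `t`. -/
def binaryNoise (z : ℕ → ℝ) (t : ℕ) : ℝ :=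
  ∑ i ∈ (Finset.range t.size).filter (fun i => t.testBit i = true), z (2 ^ i * (t / 2 ^ i))

/-- The exact count at time `t` of a stream indexed from `1`. -/
def streamCount (σ : ℕ → ℝ) (t : ℕ) : ℝ := ∑ u ∈ Finset.Ioc 0 t, σ u

theorem two_pow_mul_div_succ (t m : ℕ) :
    2 ^ m * (t / 2 ^ m) = 2 ^ (m + 1) * (t / 2 ^ (m + 1)) + if t.testBit m then 2 ^ m else 0 := by
  have h1 : t / 2 ^ (m + 1) = t / 2 ^ m / 2 := by rw [pow_succ, Nat.div_div_eq_div_mul]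
  have h2 : t.testBit m = decide (t / 2 ^ m % 2 = 1) := Nat.testBit_eq_decide_div_mod_eq
  have h3 := Nat.div_add_mod (t / 2 ^ m) 2
  rw [h1, h2]
  rcases Nat.mod_two_eq_zero_or_one (t / 2 ^ m) with h | h
  · rw [h] at h3
    simp only [h, zero_ne_one, decide_false, Bool.false_eq_true, if_false, pow_succ]
    calc 2 ^ m * (t / 2 ^ m) = 2 ^ m * (2 * (t / 2 ^ m / 2) + 0) := by rw [h3]
      _ = _ := by ring
  · rw [h] at h3
    simp only [h, decide_true, if_true, pow_succ]
    calc 2 ^ m * (t / 2 ^ m) = 2 ^ m * (2 * (t / 2 ^ m / 2) + 1) := by rw [h3]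
      _ = _ := by ring

/-- The blocks of the nonzero bits tile `(0, t]`: clearing bits from the lowest up moves the right
end from `t` down to 0, one block per nonzero bit. -/
theorem sum_dyadic_blocks (σ : ℕ → ℝ) (t m : ℕ) :
    (∑ i ∈ (Finset.range m).filter (fun i => t.testBit i = true),
      ∑ u ∈ Finset.Ioc (2 ^ i * (t / 2 ^ i) - 2 ^ i) (2 ^ i * (t / 2 ^ i)), σ u)
      + streamCount σ (2 ^ m * (t / 2 ^ m)) = streamCount σ t := by
  induction m with
  | zero => simp
  | succ m ih =>
    rw [← ih, Finset.range_add_one, Finset.filter_insert]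
    have h := two_pow_mul_div_succ t m
    by_cases hb : t.testBit m = true
    · simp only [hb, if_true] at h ⊢
      rw [Finset.sum_insert (by simp), h, Nat.add_sub_cancel]
      have := Finset.sum_Ioc_consecutive σ (Nat.zero_le (2 ^ (m + 1) * (t / 2 ^ (m + 1))))
        (Nat.le_add_right _ (2 ^ m))
      simp only [streamCount]
      rw [← this]
      ring
    · simp only [hb] at h ⊢
      simp at h
      rw [h]
      simp

theorem binaryMechanism_eq (z σ : ℕ → ℝ) (t : ℕ) :
    binaryMechanism z σ t = streamCount σ t + binaryNoise z t := by
  have h := sum_dyadic_blocks σ t t.size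
  have h0 : t / 2 ^ t.size = 0 := Nat.div_eq_of_lt (Nat.lt_size_self t)
  rw [h0] at h
  simp only [mul_zero, streamCount, Finset.Ioc_self, Finset.sum_empty, add_zero] at h
  rw [binaryMechanism, Finset.sum_add_distrib, h]
  rfl

theorem streamCount_mono {σ : ℕ → ℝ} (hσ : ∀ u, 0 ≤ σ u) : Monotone (streamCount σ) :=
  fun _ _ h => Finset.sum_le_sum_of_subset_of_nonneg (Finset.Ioc_subset_Ioc_right h)
    fun _ _ _ => hσ _

theorem streamCount_congr {σ τ : ℕ → ℝ} {t : ℕ} (h : ∀ u ≤ t, σ u = τ u) :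
    streamCount σ t = streamCount τ t :=
  Finset.sum_congr rfl fun u hu => h u (Finset.mem_Ioc.1 hu).2

theorem streamCount_update (σ : ℕ → ℝ) (t : ℕ) (x : ℝ) :
    streamCount (Function.update σ (t + 1) x) (t + 1) = streamCount σ t + x := by
  rw [streamCount, Finset.sum_Ioc_succ_top (Nat.zero_le t), Function.update_self]
  congr 1
  exact streamCount_congr fun u hu => Function.update_of_ne (by omega) _ _

theorem counter_le_counter_update (z σ : ℕ → ℝ) (t : ℕ) (x : ℝ) :
    counter z σ t ≤ counter z (Function.update σ (t + 1) x) (t + 1) := by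
  refine Finset.sup'_le _ _ fun u hu => ?_
  have hu' : u ≤ t := Nat.lt_succ_iff.1 (Finset.mem_range.1 hu)
  have h : binaryMechanism z σ u = binaryMechanism z (Function.update σ (t + 1) x) u := by
    rw [binaryMechanism_eq, binaryMechanism_eq, streamCount_congr]
    exact fun v hv => (Function.update_of_ne (by omega) _ _).symm
  rw [h]
  exact Finset.le_sup' (binaryMechanism z _) (Finset.mem_range.2 (by omega))

/-- Exact counts are monotone, so an earlier output in the running maximum exceeds the present count
by at most its own noise. Taking the maximum costs no accuracy. -/
theorem abs_counter_sub_le {z σ : ℕ → ℝ} {t : ℕ} {e : ℝ} (hσ : ∀ u, 0 ≤ σ u)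
    (hz : ∀ u ≤ t, |binaryNoise z u| ≤ e) : |counter z σ t - streamCount σ t| ≤ e := by
  rw [abs_le]
  constructor
  · have h1 : binaryMechanism z σ t ≤ counter z σ t :=
      Finset.le_sup' (binaryMechanism z σ) (Finset.self_mem_range_succ t)
    rw [binaryMechanism_eq] at h1
    linarith [(abs_le.1 (hz t le_rfl)).1]
  · have h2 : counter z σ t ≤ streamCount σ t + e := by
      refine Finset.sup'_le _ _ fun u hu => ?_
      have hu' : u ≤ t := Nat.lt_succ_iff.1 (Finset.mem_range.1 hu)
      rw [binaryMechanism_eq]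
      linarith [(abs_le.1 (hz u hu')).2, streamCount_mono hσ hu']
    linarith

/-! ### Concentration of the noise -/

/-- The end belonging to bit `i` has bit `i` set, whereas an end belonging to a higher bit `j` is a
multiple of `2 ^ j`. Distinctness makes the noise terms at time `t` distinct, hence independent. -/
theorem dyadicEnd_injOn (t : ℕ) : Set.InjOn (fun i => 2 ^ i * (t / 2 ^ i))
    {i | t.testBit i = true} := by
  have key : ∀ i j, i < j → t.testBit i = true → 2 ^ i * (t / 2 ^ i) ≠ 2 ^ j * (t / 2 ^ j) := by
    intro i j hij hi h
    have h1 : (2 ^ i * (t / 2 ^ i)).testBit i = true := by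
      rw [Nat.testBit_two_pow_mul]
      simpa [Nat.testBit_eq_decide_div_mod_eq] using hi
    rw [h, Nat.testBit_two_pow_mul] at h1
    simp at h1
    omega
  intro i hi j hj h
  rcases lt_trichotomy i j with hij | hij | hij
  · exact absurd h (key i j hij hi)
  · exact hij
  · exact absurd h.symm (key j i hij hj)

theorem mgf_abs_laplace {Ω : Type*} [MeasurableSpace Ω] {μ : Measure Ω} {X : Ω → ℝ} {b : ℝ}
    (hb : 0 < b) (hX : HasLaw X (laplace b) μ) :
    mgf (fun ω => |X ω|) μ (1 / (2 * b)) = 2 := by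
  have h1 : mgf (fun ω => |X ω|) μ (1 / (2 * b)) = ∫ x, Real.exp (1 / (2 * b) * |x|) ∂laplace b :=
    hX.integral_comp (f := fun x => Real.exp (1 / (2 * b) * |x|))
      (by fun_prop)
  rw [h1, laplace, integral_withDensity_eq_integral_toReal_smul (by fun_prop) (by simp)]
  have h2 : ∀ x : ℝ, (ENNReal.ofReal (Real.exp (-|x| / b) / (2 * b))).toReal •
      Real.exp (1 / (2 * b) * |x|) = (fun y => 1 / (2 * b) * Real.exp (-(1 / (2 * b)) * y)) |x| := by
    intro x
    rw [ENNReal.toReal_ofReal (by positivity), smul_eq_mul, div_mul_eq_mul_div, ← Real.exp_add]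
    have : -|x| / b + 1 / (2 * b) * |x| = -(1 / (2 * b)) * |x| := by field_simp; ring
    rw [this]; ring
  simp_rw [h2]
  rw [integral_comp_abs (f := fun y => 1 / (2 * b) * Real.exp (-(1 / (2 * b)) * y)),
    integral_const_mul, integral_exp_mul_Ioi (by simp; positivity)]
  simp
  field_simp

/-- Chernoff's bound at the parameter `1 / (2 b)`, where each absolute value contributes a factor of
exactly 2. -/
theorem measure_sum_abs_ge_le {ι Ω : Type*} [MeasurableSpace Ω] {μ : Measure Ω}
    [IsProbabilityMeasure μ] {X : ι → Ω → ℝ} {b : ℝ} (hb : 0 < b) (hind : iIndepFun X μ)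
    (hX : ∀ i, HasLaw (X i) (laplace b) μ) (s : Finset ι) (x : ℝ) :
    μ.real {ω | x ≤ ∑ i ∈ s, |X i ω|} ≤ 2 ^ s.card * Real.exp (-(x / (2 * b))) := by
  have hind' : iIndepFun (fun i ω => |X i ω|) μ :=
    hind.comp (fun _ y => |y|) fun _ => by fun_prop
  have hmgf : mgf (∑ i ∈ s, fun ω => |X i ω|) μ (1 / (2 * b)) = 2 ^ s.card := by
    rw [hind'.mgf_sum₀ (fun i => by have := (hX i).aemeasurable; fun_prop),
      Finset.prod_congr rfl fun i _ => mgf_abs_laplace hb (hX i), Finset.prod_const]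
  have hint : Integrable (fun ω => Real.exp (1 / (2 * b) * (∑ i ∈ s, fun ω => |X i ω|) ω)) μ := by
    -- A nonintegrable exponential would have integral 0 by convention, but the moment generating
    -- function is a power of 2.
    by_contra h
    have := integral_undef h
    rw [← mgf, hmgf] at this
    exact absurd this (by positivity)
  have := measure_ge_le_exp_mul_mgf x (by positivity : 0 ≤ 1 / (2 * b)) hint
  rw [hmgf, mul_comm] at this
  simp only [Finset.sum_apply] at this
  convert this using 3
  ring

theorem measure_binaryNoise_le {Ω : Type*} [MeasurableSpace Ω] {μ : Measure Ω}
    [IsProbabilityMeasure μ] {X : ℕ → Ω → ℝ} {b : ℝ} (hb : 0 < b) (hind : iIndepFun X μ)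
    (hX : ∀ i, HasLaw (X i) (laplace b) μ) {t : ℕ} (ht : 1 ≤ t) (x : ℝ) :
    μ.real {ω | x < |binaryNoise (fun i => X i ω) t|} ≤ 2 * t * Real.exp (-(x / (2 * b))) := by
  set I := (Finset.range t.size).filter (fun i => t.testBit i = true) with hI
  have hinj : Set.InjOn (fun i => 2 ^ i * (t / 2 ^ i)) (I : Set ℕ) :=
    (dyadicEnd_injOn t).mono fun i hi => (Finset.mem_filter.1 hi).2
  have hsub : {ω | x < |binaryNoise (fun i => X i ω) t|} ⊆
      {ω | x ≤ ∑ r ∈ I.image (fun i => 2 ^ i * (t / 2 ^ i)), |X r ω|} := by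
    intro ω hω
    rw [Set.mem_ofPred_eq, Finset.sum_image hinj]
    exact hω.le.trans (Finset.abs_sum_le_sum_abs _ _)
  refine (measureReal_mono hsub).trans ((measure_sum_abs_ge_le hb hind hX _ x).trans ?_)
  gcongr
  have hcard : (I.image (fun i => 2 ^ i * (t / 2 ^ i))).card ≤ (t.size - 1) + 1 := by
    refine Finset.card_image_le.trans ((Finset.card_filter_le _ _).trans ?_)
    rw [Finset.card_range]; omega
  -- With at most `t.size` terms, the Chernoff factor is at most twice `2 ^ (t.size - 1) ≤ t`.
  have hsize : 2 ^ (t.size - 1) ≤ t := Nat.lt_size.1 (by have := Nat.size_pos.2 ht; omega)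
  calc (2 : ℝ) ^ (I.image (fun i => 2 ^ i * (t / 2 ^ i))).card
      ≤ 2 ^ ((t.size - 1) + 1) := pow_le_pow_right₀ (by norm_num) hcard
    _ = 2 * ((2 ^ (t.size - 1) : ℕ) : ℝ) := by push_cast; ring
    _ ≤ 2 * t := by gcongr

theorem exists_accurate_event {ι Ω : Type*} [Fintype ι] [MeasurableSpace Ω] {μ : Measure Ω}
    [IsProbabilityMeasure μ] {Z : ι → ℕ → Ω → ℝ} {b x γ : ℝ} {N : ℕ} (hb : 0 < b) (hx : 0 ≤ x)
    (hind : iIndepFun (fun q : ι × ℕ => Z q.1 q.2) μ)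
    (hZ : ∀ j t, HasLaw (Z j t) (laplace b) μ)
    (hγ : Fintype.card ι * (2 * N ^ 2) * Real.exp (-(x / (2 * b))) ≤ γ) :
    ∃ A : Set Ω, MeasurableSet A ∧ ENNReal.ofReal (1 - γ) ≤ μ A ∧
      ∀ ω ∈ A, ∀ j, ∀ t ≤ N, |binaryNoise (fun i => Z j i ω) t| ≤ x := by
  set bad : ι × ℕ → Set Ω := fun q => {ω | x < |binaryNoise (fun i => Z q.1 i ω) q.2|}
  set U : Set Ω := ⋃ q ∈ (Finset.univ ×ˢ Finset.Icc 1 N : Finset (ι × ℕ)), bad q with hU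
  have hUle : μ.real U ≤ γ := by
    refine (measureReal_biUnion_finset_le _ _).trans (le_trans ?_ hγ)
    have : ∀ q ∈ (Finset.univ ×ˢ Finset.Icc 1 N : Finset (ι × ℕ)),
        μ.real (bad q) ≤ 2 * N * Real.exp (-(x / (2 * b))) := by
      intro q hq
      obtain ⟨h1, h2⟩ := Finset.mem_Icc.1 (Finset.mem_product.1 hq).2
      refine (measure_binaryNoise_le hb
        (hind.precomp (g := fun i => (q.1, i)) (Prod.mk_right_injective q.1))
        (fun i => hZ q.1 i) h1 x).trans ?_
      gcongr
    refine (Finset.sum_le_card_nsmul _ _ _ this).trans (le_of_eq ?_)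
    simp [Finset.card_product]
    ring
  -- The random variables are only almost everywhere measurable, so the bad event is replaced by a
  -- measurable superset of equal measure.
  refine ⟨(toMeasurable μ U)ᶜ, (measurableSet_toMeasurable _ _).compl, ?_, ?_⟩
  · rw [← ofReal_measureReal]
    apply ENNReal.ofReal_le_ofReal
    rw [probReal_compl_eq_one_sub (measurableSet_toMeasurable _ _), measureReal_def,
      measure_toMeasurable, ← measureReal_def]
    linarith
  · intro ω hω j t ht
    rcases Nat.eq_zero_or_pos t with rfl | h0
    · simpa [binaryNoise] using hx
    by_contra h
    refine hω (subset_toMeasurable _ _ ?_)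
    simp only [hU, Set.mem_iUnion]
    exact ⟨(j, t), by simp; omega, not_le.1 h⟩

/-! ### Estimates of the parameters -/

theorem log_le_logb {B x : ℝ} (hB : 1 < B) (hBe : B ≤ Real.exp 1) (hx : 1 ≤ x) :
    Real.log x ≤ Real.logb B x := by
  have h0 : 0 < Real.log B := Real.log_pos hB
  have h1 : Real.log B ≤ 1 := by
    simpa using Real.log_le_log (by linarith) hBe
  rw [Real.logb, le_div_iff₀ h0]
  nlinarith [Real.log_nonneg hx]

theorem rpow_five_halves {x : ℝ} (hx : 0 < x) : x ^ (5 / 2 : ℝ) = x ^ 2 * √x := by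
  rw [Real.sqrt_eq_rpow, ← Real.rpow_natCast x 2, ← Real.rpow_add hx]
  norm_num

theorem four_le_log {x : ℝ} (hx : 90 ≤ x) : 4 ≤ Real.log x := by
  rw [Real.le_log_iff_exp_le (by linarith)]
  have h := Real.exp_one_lt_d9
  have h0 := Real.exp_pos 1
  have : Real.exp 4 = Real.exp 1 ^ 4 := by rw [← Real.exp_nat_mul]; norm_num
  rw [this]
  calc Real.exp 1 ^ 4 ≤ 2.72 ^ 4 := pow_le_pow_left₀ h0.le (by linarith) 4
    _ ≤ x := by norm_num; linarith

theorem log_four_ge : 1.38 ≤ Real.log 4 := by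
  have : Real.log 4 = 2 * Real.log 2 := by
    rw [show (4 : ℝ) = 2 ^ 2 by norm_num, Real.log_pow]; norm_num
  linarith [Real.log_two_gt_d9]

theorem log_four_le : Real.log 4 ≤ 2 := by
  have : Real.log 4 = 2 * Real.log 2 := by
    rw [show (4 : ℝ) = 2 ^ 2 by norm_num, Real.log_pow]; norm_num
  linarith [Real.log_two_lt_d9]

theorem log_ninety_le : Real.log 90 ≤ 5 := by
  rw [Real.log_le_iff_le_exp (by norm_num)]
  have h := Real.exp_one_gt_d9
  have : Real.exp 5 = Real.exp 1 ^ 5 := by rw [← Real.exp_nat_mul]; norm_num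
  rw [this]
  calc (90 : ℝ) ≤ 2.7 ^ 5 := by norm_num
    _ ≤ _ := pow_le_pow_left₀ (by norm_num) (by linarith) 5

theorem PAllocParams.T_eq (B α γ ε : ℝ) :
    (⟨α / 3, α / 3, ε, γ, B⟩ : PAllocParams).T = 90 / α ^ 2 := by
  rw [PAllocParams.T]; simp only
  rcases eq_or_ne α 0 with rfl | h
  · simp
  · field_simp; norm_num

theorem PAllocParams.E_eq_supplyError {B α γ ε : ℝ} (hα : 0 < α) (hε : 0 < ε) (n k : ℕ) :
    (⟨α / 3, α / 3, ε, γ, B⟩ : PAllocParams).E n k = supplyError B α γ ε n k := by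
  rw [PAllocParams.E, PAllocParams.eps', PAllocParams.T_eq, supplyError]
  simp only
  have h1 : 2 * √2 / (ε / (2 * (90 / α ^ 2))) = 360 * √2 / (α ^ 2 * ε) := by
    field_simp; norm_num
  have h2 : (n : ℝ) * (90 / α ^ 2) = 90 * n / α ^ 2 := by ring
  rw [h1, h2]

/-- Here `L` and `Λ` are natural logarithms of `n T` and `4 k / γ`, and `Lb`, `Λb` those to base
`B`. Since `L ≥ 4`, the factor `√(2 Lb)` is at least 2.5, and `2.5 L Λ` beats the left side. -/
theorem noise_tail_le {L Lb Λ Λb : ℝ} (hL : 4 ≤ L) (hLb : L ≤ Lb) (hΛ : 1.38 ≤ Λ)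
    (hΛb : Λ ≤ Λb) : Real.log 4 + Λ + 2 * L ≤ √2 * (Lb * √Lb) * Λb := by
  have h1 : 2.5 ≤ √2 * √Lb := by
    rw [← Real.sqrt_mul (by norm_num)]
    exact Real.le_sqrt_of_sq_le (by norm_num; linarith)
  have h2 : L * Λ ≤ Lb * Λb := by gcongr; linarith
  have h3 : 2.5 * (L * Λ) ≤ √2 * √Lb * (Lb * Λb) := by
    apply mul_le_mul h1 h2 (by nlinarith) (by positivity)
  have h4 := log_four_le
  nlinarith

/-- The factor `L ^ (5 / 2)` in `E` loses one power of `L` to the noise scale; the remaining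
exponent dominates the logarithm of `16 k (n T) ^ 2 / γ`, which pays for the union bound over at
most `2 k` counters and `2 n T` times. -/
theorem noise_union_bound {B α γ ε : ℝ} {n k : ℕ} (hB : 1 < B) (hBe : B ≤ Real.exp 1)
    (hα : 0 < α) (hα1 : α ≤ 1) (hγ : 0 < γ) (hγ1 : γ < 1) (hε : 0 < ε) (hn : 1 ≤ n) (hk : 1 ≤ k) :
    let P : PAllocParams := ⟨α / 3, α / 3, ε, γ, B⟩
    0 < P.noiseScale n ∧ 0 ≤ P.E n k - 1 ∧
    (Fintype.card (Option (Fin k)) : ℝ) * (2 * ((n * ⌈P.T⌉₊ : ℕ) : ℝ) ^ 2) *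
      Real.exp (-((P.E n k - 1) / (2 * P.noiseScale n))) ≤ γ := by
  intro P
  have hn' : (1 : ℝ) ≤ n := by exact_mod_cast hn
  have hk' : (1 : ℝ) ≤ k := by exact_mod_cast hk
  have hT : P.T = 90 / α ^ 2 := PAllocParams.T_eq B α γ ε
  have hT90 : 90 ≤ P.T := by
    rw [hT, le_div_iff₀ (by positivity)]
    nlinarith
  set X : ℝ := n * P.T with hX
  have hX90 : 90 ≤ X := by nlinarith
  have hL := four_le_log hX90
  have hLb : Real.log X ≤ Real.logb B X := log_le_logb hB hBe (by linarith)
  have hkγ : 4 ≤ 4 * k / γ := by rw [le_div_iff₀ hγ]; nlinarith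
  have hΛ : 1.38 ≤ Real.log (4 * k / γ) :=
    log_four_ge.trans (Real.log_le_log (by norm_num) hkγ)
  have hΛb : Real.log (4 * k / γ) ≤ Real.logb B (4 * k / γ) := log_le_logb hB hBe (by linarith)
  have heps : 0 < P.eps' := by
    have : P.eps' = ε / (2 * P.T) := rfl
    rw [this]; positivity
  have hb : P.noiseScale n = Real.logb B X / P.eps' := rfl
  have hE : P.E n k - 1 = 2 * √2 / P.eps' * (Real.logb B X ^ 2 * √(Real.logb B X)) *
      Real.logb B (4 * k / γ) := by
    rw [← rpow_five_halves (by linarith)]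
    have : P.E n k = 2 * √2 / P.eps' * Real.logb B X ^ (5 / 2 : ℝ) * Real.logb B (4 * k / γ) + 1 :=
      rfl
    linarith
  have hLb0 : 0 < Real.logb B X := by linarith
  refine ⟨by rw [hb]; positivity, ?_, ?_⟩
  · rw [hE]
    have : 0 ≤ Real.logb B (4 * k / γ) := by linarith
    positivity
  have hquot : (P.E n k - 1) / (2 * P.noiseScale n) =
      √2 * (Real.logb B X * √(Real.logb B X)) * Real.logb B (4 * k / γ) := by
    rw [hE, hb]
    field_simp
  rw [hquot]
  have htail := noise_tail_le hL hLb hΛ hΛb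
  have hN : ((n * ⌈P.T⌉₊ : ℕ) : ℝ) ≤ 2 * X := by
    push_cast
    have := Nat.ceil_lt_add_one (by linarith : 0 ≤ P.T)
    rw [hX]
    nlinarith
  have hcard : (Fintype.card (Option (Fin k)) : ℝ) ≤ 2 * k := by
    simp; linarith
  have hexp : Real.exp (-(√2 * (Real.logb B X * √(Real.logb B X)) * Real.logb B (4 * k / γ))) ≤
      (4 * (4 * k / γ) * X ^ 2)⁻¹ := by
    rw [Real.exp_neg]
    apply inv_anti₀ (by positivity)
    refine le_trans (le_of_eq ?_) (Real.exp_le_exp.2 htail)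
    rw [Real.exp_add, Real.exp_add, Real.exp_log (by norm_num), Real.exp_log (by positivity),
      two_mul, Real.exp_add, Real.exp_log (by positivity)]
    ring
  calc _ ≤ (2 * k) * (2 * (2 * X) ^ 2) * (4 * (4 * k / γ) * X ^ 2)⁻¹ := by gcongr
    _ = γ := by field_simp; norm_num

theorem supplyError_bound_polylog {B : ℝ} (hB : 1 < B) (hBe : B ≤ Real.exp 1) :
    ∃ c : ℕ, ∀ ε₀ : ℝ, 0 < ε₀ → ∃ C : ℝ, 0 < C ∧
      ∀ (n k : ℕ) (α γ ε : ℝ), 1 ≤ n → 1 ≤ k → 0 < α → α ≤ 1 → 0 < γ → γ ≤ 1 →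
        0 < ε → ε ≤ ε₀ →
        (12 * supplyError B α γ ε n k + 3) / α ≤
          C * (1 / (α ^ 3 * ε)) *
            (1 + Real.log n + Real.log k + Real.log (1 / α) + Real.log (1 / γ)) ^ c := by
  -- The exponent `5 / 2` is rounded up to 3, and the second logarithm adds 1.
  refine ⟨4, fun ε₀ hε₀ => ?_⟩
  set β := 1 / Real.log B with hβ
  have hlB : 0 < Real.log B := Real.log_pos hB
  have hβ1 : 1 ≤ β := by
    rw [hβ, le_div_iff₀ hlB]
    simpa using Real.log_le_log (by linarith) hBe
  refine ⟨12 * 360 * √2 * 250 * β ^ 4 + 15 * ε₀, by positivity, ?_⟩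
  intro n k α γ ε hn hk hα hα1 hγ hγ1 hε hεε
  have hn' : (1 : ℝ) ≤ n := by exact_mod_cast hn
  have hk' : (1 : ℝ) ≤ k := by exact_mod_cast hk
  have l1 := Real.log_nonneg hn'
  have l2 := Real.log_nonneg hk'
  have l3 : 0 ≤ Real.log (1 / α) := Real.log_nonneg (by rw [le_div_iff₀ hα]; linarith)
  have l4 : 0 ≤ Real.log (1 / γ) := Real.log_nonneg (by rw [le_div_iff₀ hγ]; linarith)
  set S := 1 + Real.log n + Real.log k + Real.log (1 / α) + Real.log (1 / γ) with hS
  have hS1 : 1 ≤ S := by linarith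
  have hlog1 : Real.logb B (90 * n / α ^ 2) ≤ 5 * β * S := by
    have h : Real.log (90 * n / α ^ 2) = Real.log 90 + Real.log n + 2 * Real.log (1 / α) := by
      rw [show 90 * (n : ℝ) / α ^ 2 = 90 * n * (1 / α) ^ 2 by field_simp,
        Real.log_mul (by positivity) (by positivity), Real.log_mul (by norm_num) (by positivity),
        Real.log_pow]
      norm_num
    rw [Real.logb, h, div_le_iff₀ hlB]
    have : 5 * β * S * Real.log B = 5 * S := by rw [hβ]; field_simp
    rw [this]
    linarith [log_ninety_le]
  have hlog1' : 0 ≤ Real.logb B (90 * n / α ^ 2) := by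
    apply Real.logb_nonneg hB
    rw [le_div_iff₀ (by positivity)]
    nlinarith
  have hlog2 : Real.logb B (4 * k / γ) ≤ 2 * β * S := by
    have h : Real.log (4 * k / γ) = Real.log 4 + Real.log k + Real.log (1 / γ) := by
      rw [show 4 * (k : ℝ) / γ = 4 * k * (1 / γ) by field_simp,
        Real.log_mul (by positivity) (by positivity), Real.log_mul (by norm_num) (by positivity)]
    rw [Real.logb, h, div_le_iff₀ hlB]
    have : 2 * β * S * Real.log B = 2 * S := by rw [hβ]; field_simp
    rw [this]
    linarith [log_four_le]
  have hlog2' : 0 ≤ Real.logb B (4 * k / γ) := by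
    apply Real.logb_nonneg hB
    rw [le_div_iff₀ hγ]
    linarith
  have hpow : Real.logb B (90 * n / α ^ 2) ^ (5 / 2 : ℝ) ≤ (5 * β * S) ^ 3 := by
    refine (Real.rpow_le_rpow hlog1' hlog1 (by norm_num)).trans ?_
    rw [← Real.rpow_natCast (5 * β * S) 3]
    exact Real.rpow_le_rpow_of_exponent_le (by nlinarith) (by norm_num)
  have hmain : 360 * √2 / (α ^ 2 * ε) * Real.logb B (90 * n / α ^ 2) ^ (5 / 2 : ℝ)
      * Real.logb B (4 * k / γ) ≤ 360 * √2 / (α ^ 2 * ε) * (5 * β * S) ^ 3 * (2 * β * S) := by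
    have := Real.rpow_nonneg hlog1' (5 / 2)
    gcongr
  -- The additive constants `12 + 3` are not multiples of `1 / ε`; absorbing them is where `ε ≤ ε₀`
  -- enters.
  have h15 : (15 : ℝ) / α ≤ 15 * ε₀ * (1 / (α ^ 3 * ε)) * S ^ 4 := by
    have h1 : (1 : ℝ) ≤ S ^ 4 := one_le_pow₀ hS1
    have h2 : 15 / α ≤ 15 * ε₀ * (1 / (α ^ 3 * ε)) := by
      have h3 : α ^ 2 ≤ 1 := pow_le_one₀ hα.le hα1
      rw [mul_one_div, div_le_div_iff₀ hα (by positivity)]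
      have : α ^ 3 * ε ≤ α * ε₀ := by
        calc α ^ 3 * ε = α ^ 2 * (α * ε) := by ring
          _ ≤ 1 * (α * ε₀) := by gcongr
          _ = _ := one_mul _
      nlinarith
    exact h2.trans (le_mul_of_one_le_right (by positivity) h1)
  calc (12 * supplyError B α γ ε n k + 3) / α
      ≤ (12 * (360 * √2 / (α ^ 2 * ε) * (5 * β * S) ^ 3 * (2 * β * S) + 1) + 3) / α := by
        rw [supplyError]; gcongr
    _ = 12 * 360 * √2 * 250 * β ^ 4 * (1 / (α ^ 3 * ε)) * S ^ 4 + 15 / α := by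
        field_simp; ring
    _ ≤ _ := by linarith

namespace PAlloc

variable {n k : ℕ} {G : Type*}

/-! ### Invariants of the auction -/

/-- The number of bids on type `j` so far. -/
def bidCount (st : AuctionState n k G) (j : Fin k) : ℝ := streamCount (st.bids j) st.clock

/-- The number of reports to continue bidding so far. -/
def repCount (st : AuctionState n k G) : ℝ := streamCount st.reports st.repClock

/-- The price at which bidder `i` can have the good `g`: the price she bid, if she holds it, and
the current price otherwise. -/
def heldPrice [DecidableEq G] (M : Market n k G) (P : PAllocParams) (st : AuctionState n k G)
    (i : Fin n) (g : G) : ℝ :=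
  if g ∈ st.bundle i then P.incr * ⌊st.mark i g / effSupply M P⌋₊ else price M P st g

/-- The noise of the counters is at most `e` up to time `N`. -/
def Accurate (z : Option (Fin k) → ℕ → ℝ) (e : ℝ) (N : ℕ) : Prop :=
  ∀ j, ∀ t ≤ N, |binaryNoise (z j) t| ≤ e

/-- The relation between bids, counters and price levels. -/
structure CountInv (M : Market n k G) (P : PAllocParams) (z : Option (Fin k) → ℕ → ℝ) (e : ℝ)
    (st : AuctionState n k G) : Prop where
  bids_nonneg : ∀ j u, 0 ≤ st.bids j u
  exists_nat : ∀ j, ∃ c : ℕ, bidCount st j = c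
  level_le : ∀ j, st.level j * effSupply M P ≤ count z st j
  lt_level : ∀ j, count z st j < (st.level j + 1) * effSupply M P
  bidCount_lt : ∀ j, ∃ l : ℕ, P.incr * l ≤ 1 ∧ bidCount st j < (l + 1) * effSupply M P + e + 1

/-- `idx i g` is the number of earlier bids on the type of `g` when bidder `i` last bid on `g`. -/
structure HeldInv (M : Market n k G) (P : PAllocParams) (z : Option (Fin k) → ℕ → ℝ) (e : ℝ)
    (st : AuctionState n k G) (idx : Fin n → G → ℕ) : Prop where
  mark_le : ∀ i, ∀ g ∈ st.bundle i, st.mark i g ≤ count z st (M.kind g)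
  idx_lt : ∀ i, ∀ g ∈ st.bundle i, (idx i g : ℝ) < bidCount st (M.kind g)
  abs_mark_sub_le : ∀ i, ∀ g ∈ st.bundle i, |st.mark i g - idx i g| ≤ e
  inj : ∀ i, ∀ g ∈ st.bundle i, ∀ i', ∀ g' ∈ st.bundle i', M.kind g = M.kind g' →
    idx i g = idx i' g' → i = i' ∧ g = g'
  surj : ∀ j, ∀ b : ℕ, (b : ℝ) < bidCount st j →
    (∃ i, ∃ g ∈ st.bundle i, M.kind g = j ∧ idx i g = b) ∨ b - e ≤ count z st j - effSupply M P

/-- Every bidder holds a part of a most demanded bundle. -/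
def DemandInv [DecidableEq G] (M : Market n k G) (P : PAllocParams) (st : AuctionState n k G) :
    Prop :=
  ∀ i, ∃ S ∈ demand (M.val i) (heldPrice M P st i), st.bundle i ⊆ S

structure Inv [DecidableEq G] (M : Market n k G) (P : PAllocParams) (z : Option (Fin k) → ℕ → ℝ)
    (e : ℝ) (st : AuctionState n k G) : Prop where
  counts : CountInv M P z e st
  held : ∃ idx, HeldInv M P z e st idx
  demanded : DemandInv M P st

/-- Conditions on the market, the parameters and the noise under which the auction is analyzed. -/
structure Regular (M : Market n k G) (P : PAllocParams) (z : Option (Fin k) → ℕ → ℝ) (e : ℝ)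
    (N : ℕ) : Prop where
  incr_pos : 0 < P.incr
  err_nonneg : 0 ≤ e
  err_lt : 2 * e + 1 < effSupply M P
  accurate : Accurate z e N
  substitutes : ∀ i, GrossSubstitutes (M.val i)
  val_mem : ∀ i S, M.val i S ∈ Set.Icc (0 : ℝ) 1

variable {M : Market n k G} {P : PAllocParams} {z : Option (Fin k) → ℕ → ℝ} {e : ℝ} {N : ℕ}
  {st st' : AuctionState n k G}

theorem Regular.supply_pos (hR : Regular M P z e N) : 0 < effSupply M P := by
  linarith [hR.err_nonneg, hR.err_lt]

theorem CountInv.congr (h : CountInv M P z e st) (hb : st'.bids = st.bids)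
    (hc : st'.clock = st.clock) (hl : st'.level = st.level) : CountInv M P z e st' := by
  have h1 : ∀ j, bidCount st' j = bidCount st j := fun j => by rw [bidCount, hb, hc, bidCount]
  have h2 : ∀ j, count z st' j = count z st j := fun j => by rw [count, hb, hc, count]
  exact ⟨by rw [hb]; exact h.1, fun j => by rw [h1]; exact h.2 j,
    fun j => by rw [h2, hl]; exact h.3 j, fun j => by rw [h2, hl]; exact h.4 j,
    fun j => by rw [h1]; exact h.5 j⟩

theorem CountInv.abs_count_sub_le (h : CountInv M P z e st) (hz : Accurate z e N)
    (hN : st.clock ≤ N) (j : Fin k) : |count z st j - bidCount st j| ≤ e :=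
  abs_counter_sub_le (h.bids_nonneg j) fun u hu => hz _ u (hu.trans hN)

theorem CountInv.floor_le (h : CountInv M P z e st) (hD : 0 < effSupply M P) {j : Fin k} {x : ℝ}
    (hx : x ≤ count z st j) : ⌊x / effSupply M P⌋₊ ≤ st.level j := by
  rw [← Nat.lt_add_one_iff, Nat.floor_lt' (Nat.succ_ne_zero _), div_lt_iff₀ hD]
  push_cast
  exact hx.trans_lt (h.lt_level j)

theorem CountInv.floor_count (h : CountInv M P z e st) (hD : 0 < effSupply M P) (j : Fin k) :
    ⌊count z st j / effSupply M P⌋₊ = st.level j :=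
  le_antisymm (h.floor_le hD le_rfl) (Nat.le_floor ((le_div_iff₀ hD).2 (h.level_le j)))

/-! ### Feeding the counters -/

section bid

open scoped Classical in
theorem bidCount_bid (b : Option (Fin k)) (j : Fin k) :
    bidCount (bid M P z st b) j = bidCount st j + if b = some j then 1 else 0 :=
  streamCount_update _ _ _

theorem count_le_count_bid (b : Option (Fin k)) (j : Fin k) :
    count z st j ≤ count z (bid M P z st b) j :=
  counter_le_counter_update _ _ _ _

theorem level_le_level_bid (b : Option (Fin k)) (j : Fin k) :
    st.level j ≤ (bid M P z st b).level j := by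
  simp only [bid]
  split_ifs <;> omega

theorem CountInv.bid (hR : Regular M P z e N) (h : CountInv M P z e st) (hN : st.clock + 1 ≤ N)
    (b : Option (Fin k)) (hb : ∀ j, b = some j → P.incr * st.level j ≤ 1) :
    CountInv M P z e (bid M P z st b) := by
  classical
  have hD := hR.supply_pos
  have hnonneg : ∀ j u, 0 ≤ (PAlloc.bid M P z st b).bids j u := by
    intro j u
    simp only [PAlloc.bid, Function.update_apply]
    split_ifs
    · exact zero_le_one
    · exact le_rfl
    · exact h.bids_nonneg j u
  have hacc : ∀ j, |count z (PAlloc.bid M P z st b) j - bidCount (PAlloc.bid M P z st b) j| ≤ e :=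
    fun j => abs_counter_sub_le (hnonneg j) fun u hu => hR.accurate _ u (le_trans hu hN)
  have hacc' := h.abs_count_sub_le hR.accurate (by omega : st.clock ≤ N)
  -- One step moves a count by at most `2 e + 1 < D`, so a single increment of the level always
  -- catches up with the count.
  have hupper : ∀ j, count z (PAlloc.bid M P z st b) j < (st.level j + 1 + 1) * effSupply M P := by
    intro j
    have h1 := abs_le.1 (hacc j)
    have h2 := abs_le.1 (hacc' j)
    have h3 := bidCount_bid (M := M) (P := P) (z := z) (st := st) b j
    have h4 : (if b = some j then 1 else 0 : ℝ) ≤ 1 := by split_ifs <;> norm_num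
    have h5 := h.lt_level j
    have h6 := hR.err_lt
    nlinarith
  have hlevel : ∀ j, (PAlloc.bid M P z st b).level j =
      if (st.level j + 1) * effSupply M P ≤ count z (PAlloc.bid M P z st b) j
      then st.level j + 1 else st.level j := fun j => rfl
  refine ⟨hnonneg, fun j => ?_, fun j => ?_, fun j => ?_, fun j => ?_⟩
  · obtain ⟨c, hc⟩ := h.exists_nat j
    rw [bidCount_bid, hc]
    split_ifs
    · exact ⟨c + 1, by push_cast; ring⟩
    · exact ⟨c, by ring⟩
  · rw [hlevel]
    split_ifs with hif
    · push_cast; exact hif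
    · exact (h.level_le j).trans (count_le_count_bid b j)
  · rw [hlevel]
    split_ifs with hif
    · push_cast; exact hupper j
    · exact not_le.1 hif
  · rw [bidCount_bid]
    split_ifs with hif
    · refine ⟨st.level j, hb j hif, ?_⟩
      linarith [h.lt_level j, (abs_le.1 (hacc' j)).1]
    · simpa using h.bidCount_lt j

theorem HeldInv.bid_none {idx : Fin n → G → ℕ} (h : HeldInv M P z e st idx) :
    HeldInv M P z e (bid M P z st none) idx := by
  have hc : ∀ j, bidCount (bid M P z st none) j = bidCount st j := fun j => by
    rw [bidCount_bid]; simp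
  refine ⟨fun i g hg => (h.mark_le i g hg).trans (count_le_count_bid none _), fun i g hg => ?_,
    h.abs_mark_sub_le, h.inj, fun j b hb => ?_⟩
  · rw [hc]; exact h.idx_lt i g hg
  · rw [hc] at hb
    refine (h.surj j b hb).imp_right fun h' => h'.trans ?_
    linarith [count_le_count_bid (M := M) (P := P) (z := z) (st := st) none j]

end bid

/-! ### Dropping and adding goods -/

section bundles

theorem mem_dropOutbid {i i' : Fin n} {g : G} :
    g ∈ (dropOutbid M P z st i).bundle i' ↔ g ∈ st.bundle i' ∧
      (i' = i → count z st (M.kind g) - st.mark i g < effSupply M P) := by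
  rcases eq_or_ne i' i with rfl | hi
  · simp [dropOutbid]
  · simp [dropOutbid, hi]

theorem dropOutbid_bundle_of_ne {i i' : Fin n} (h : i' ≠ i) :
    (dropOutbid M P z st i).bundle i' = st.bundle i' := by
  simp [dropOutbid, h]

theorem dropOutbid_subset (i i' : Fin n) : (dropOutbid M P z st i).bundle i' ⊆ st.bundle i' :=
  fun _ hg => (mem_dropOutbid.1 hg).1

/-- A dropped good has a mark at least `D` below the count, so its index moves to the second
alternative of `surj`. That alternative is never left, because counts do not decrease. -/
theorem HeldInv.dropOutbid {idx : Fin n → G → ℕ} (h : HeldInv M P z e st idx) (i : Fin n) :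
    HeldInv M P z e (dropOutbid M P z st i) idx := by
  have hs : ∀ i' g, g ∈ (PAlloc.dropOutbid M P z st i).bundle i' → g ∈ st.bundle i' :=
    fun i' g hg => dropOutbid_subset i i' hg
  refine ⟨fun i' g hg => h.mark_le i' g (hs i' g hg), fun i' g hg => h.idx_lt i' g (hs i' g hg),
    fun i' g hg => h.abs_mark_sub_le i' g (hs i' g hg),
    fun i' g hg i'' g' hg' => h.inj i' g (hs i' g hg) i'' g' (hs i'' g' hg'), fun j b hb => ?_⟩
  rcases h.surj j b hb with ⟨i', g, hg, rfl, rfl⟩ | h'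
  · by_cases hd : i' = i → count z st (M.kind g) - st.mark i g < effSupply M P
    · exact Or.inl ⟨i', g, mem_dropOutbid.2 ⟨hg, hd⟩, rfl, rfl⟩
    · right
      push Not at hd
      obtain ⟨rfl, hd⟩ := hd
      have := (abs_le.1 (h.abs_mark_sub_le i' g hg)).1
      change _ ≤ count z st (M.kind g) - _
      linarith
  · exact Or.inr h'

variable [DecidableEq G]

/-- Bidder `i` adds the good `g` to her bundle. -/
def addGood (M : Market n k G) (z : Option (Fin k) → ℕ → ℝ) (st : AuctionState n k G) (i : Fin n)
    (g : G) : AuctionState n k G :=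
  { st with
    bundle := Function.update st.bundle i (insert g (st.bundle i))
    mark := Function.update st.mark i
      (Function.update (st.mark i) g (count z st (M.kind g))) }

theorem mem_addGood {i i' : Fin n} {g g' : G} :
    g' ∈ (addGood M z st i g).bundle i' ↔ (i' = i ∧ g' = g) ∨ g' ∈ st.bundle i' := by
  rcases eq_or_ne i' i with rfl | hi
  · simp [addGood]
  · simp [addGood, hi]

theorem addGood_bundle_of_ne {i i' : Fin n} {g : G} (h : i' ≠ i) :
    (addGood M z st i g).bundle i' = st.bundle i' := by
  simp [addGood, h]

theorem addGood_mark_self (i : Fin n) (g : G) :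
    (addGood M z st i g).mark i g = count z st (M.kind g) := by
  simp [addGood]

theorem addGood_mark_of_ne {i i' : Fin n} {g g' : G} (h : ¬ (i' = i ∧ g' = g)) :
    (addGood M z st i g).mark i' g' = st.mark i' g' := by
  rcases eq_or_ne i' i with rfl | hi
  · simp at h
    simp [addGood, h]
  · simp [addGood, hi]

theorem HeldInv.bid_addGood (hR : Regular M P z e N) (hC : CountInv M P z e st)
    (hN : st.clock ≤ N) {idx : Fin n → G → ℕ} (h : HeldInv M P z e st idx) {i : Fin n} {g : G}
    (hg : g ∉ st.bundle i) :
    ∃ idx', HeldInv M P z e (bid M P z (addGood M z st i g) (some (M.kind g))) idx' := by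
  classical
  obtain ⟨c, hc⟩ := hC.exists_nat (M.kind g)
  set st₃ := bid M P z (addGood M z st i g) (some (M.kind g)) with hst₃
  have hcount : ∀ j, count z st j ≤ count z st₃ j := fun j =>
    count_le_count_bid (st := addGood M z st i g) (some (M.kind g)) j
  have hbid : ∀ j, bidCount st₃ j = bidCount st j + if some (M.kind g) = some j then 1 else 0 :=
    fun j => bidCount_bid (st := addGood M z st i g) (some (M.kind g)) j
  have hbid_le : ∀ j, bidCount st j ≤ bidCount st₃ j := fun j => by
    rw [hbid]; split_ifs <;> simp
  have hbid_self : bidCount st₃ (M.kind g) = c + 1 := by rw [hbid, hc]; simp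
  have hmem : ∀ i' g', g' ∈ st₃.bundle i' →
      (i' = i ∧ g' = g) ∨ (¬ (i' = i ∧ g' = g) ∧ g' ∈ st.bundle i') := by
    intro i' g' h'
    by_cases hq : i' = i ∧ g' = g
    · exact Or.inl hq
    · exact Or.inr ⟨hq, ((mem_addGood (M := M) (z := z)).1 h').resolve_left hq⟩
  have hmark_self : st₃.mark i g = count z st (M.kind g) := addGood_mark_self i g
  have hmark : ∀ i' g', ¬ (i' = i ∧ g' = g) → st₃.mark i' g' = st.mark i' g' :=
    fun i' g' hq => addGood_mark_of_ne hq
  -- The new copy is indexed by the number `c` of earlier bids, larger than all indices in use for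
  -- this type.
  set idx' : Fin n → G → ℕ := fun i' g' => if i' = i ∧ g' = g then c else idx i' g' with hidx'
  have hidx_self : idx' i g = c := by simp [hidx']
  have hidx : ∀ i' g', ¬ (i' = i ∧ g' = g) → idx' i' g' = idx i' g' := fun i' g' hq => by
    simp only [hidx', if_neg hq]
  refine ⟨idx', ?_, ?_, ?_, ?_, ?_⟩
  · intro i' g' h'
    rcases hmem i' g' h' with ⟨rfl, rfl⟩ | ⟨hq, h'⟩
    · rw [hmark_self]; exact hcount _
    · rw [hmark _ _ hq]; exact (h.mark_le i' g' h').trans (hcount _)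
  · intro i' g' h'
    rcases hmem i' g' h' with ⟨rfl, rfl⟩ | ⟨hq, h'⟩
    · rw [hidx_self, hbid_self]; linarith
    · rw [hidx _ _ hq]; exact (h.idx_lt i' g' h').trans_le (hbid_le _)
  · intro i' g' h'
    rcases hmem i' g' h' with ⟨rfl, rfl⟩ | ⟨hq, h'⟩
    · rw [hidx_self, hmark_self, ← hc]; exact hC.abs_count_sub_le hR.accurate hN _
    · rw [hidx _ _ hq, hmark _ _ hq]; exact h.abs_mark_sub_le i' g' h'
  · have hlt : ∀ i' g', g' ∈ st.bundle i' → M.kind g' = M.kind g → idx i' g' < c := by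
      intro i' g' h' hk
      have := h.idx_lt i' g' h'
      rw [hk, hc] at this
      exact_mod_cast this
    intro i₁ g₁ h₁ i₂ g₂ h₂ hk heq
    rcases hmem i₁ g₁ h₁ with ⟨rfl, rfl⟩ | ⟨hq₁, h₁'⟩ <;>
      rcases hmem i₂ g₂ h₂ with ⟨rfl, rfl⟩ | ⟨hq₂, h₂'⟩
    · exact ⟨rfl, rfl⟩
    · rw [hidx_self, hidx _ _ hq₂] at heq
      have := hlt i₂ g₂ h₂' hk.symm
      omega
    · rw [hidx_self, hidx _ _ hq₁] at heq
      have := hlt i₁ g₁ h₁' hk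
      omega
    · rw [hidx _ _ hq₁, hidx _ _ hq₂] at heq
      exact h.inj i₁ g₁ h₁' i₂ g₂ h₂' hk heq
  · intro j b hb
    by_cases hlt : (b : ℝ) < bidCount st j
    · rcases h.surj j b hlt with ⟨i', g', h', hk, hi⟩ | h'
      · refine Or.inl ⟨i', g', (mem_addGood (M := M) (z := z)).2 (Or.inr h'), hk, ?_⟩
        rw [hidx, hi]
        rintro ⟨rfl, rfl⟩
        exact hg h'
      · right
        linarith [hcount j]
    · have hj : M.kind g = j := by
        by_contra hne
        rw [hbid, if_neg (by simpa using hne), add_zero] at hb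
        exact hlt hb
      subst hj
      rw [hbid_self] at hb
      rw [hc] at hlt
      have h1 : b < c + 1 := by exact_mod_cast hb
      have h2 : ¬ b < c := by exact_mod_cast hlt
      exact Or.inl ⟨i, g, (mem_addGood (M := M) (z := z)).2 (Or.inl ⟨rfl, rfl⟩), rfl,
        by rw [hidx_self]; omega⟩

end bundles

/-! ### Demanded bundles -/

section demand

theorem price_nonneg (hP : 0 < P.incr) (g : G) : 0 ≤ price M P st g := by
  rw [price]; positivity

variable [DecidableEq G]

theorem heldPrice_nonneg (hP : 0 < P.incr) (i : Fin n) (g : G) : 0 ≤ heldPrice M P st i g := by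
  rw [heldPrice]
  split_ifs
  · positivity
  · exact price_nonneg hP g

/-- A good still held keeps its price. A dropped good passes from the price of its mark to the
current, no lower price, and other goods can only get dearer. So gross substitutes keeps the
remaining bundle inside a demanded one. -/
theorem DemandInv.of_drop_of_raise (hR : Regular M P z e N) (h : DemandInv M P st)
    (hfloor : ∀ i, ∀ g ∈ st.bundle i, ⌊st.mark i g / effSupply M P⌋₊ ≤ st.level (M.kind g))
    (hsub : ∀ i, st'.bundle i ⊆ st.bundle i) (hmark : st'.mark = st.mark)
    (hlevel : ∀ j, st.level j ≤ st'.level j) : DemandInv M P st' := by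
  intro i
  obtain ⟨S, hS, hsS⟩ := h i
  have hprice : ∀ g, price M P st g ≤ price M P st' g := fun g =>
    mul_le_mul_of_nonneg_left (by exact_mod_cast hlevel _) hR.incr_pos.le
  refine hR.substitutes i _ _ (heldPrice_nonneg hR.incr_pos i) (fun g => ?_) S hS _
    ((hsub i).trans hsS) (fun g hg => ?_)
  · rw [heldPrice, heldPrice, hmark]
    by_cases h1 : g ∈ st'.bundle i
    · rw [if_pos h1, if_pos (hsub i h1)]
    · rw [if_neg h1]
      split_ifs with h2
      · refine le_trans ?_ (hprice g)
        exact mul_le_mul_of_nonneg_left (by exact_mod_cast hfloor i g h2) hR.incr_pos.le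
      · exact hprice g
  · rw [heldPrice, heldPrice, hmark, if_pos hg, if_pos (hsub i hg)]

/-- Among bundles containing `S`, the cost of `S` is a sunk constant, so comparing extension values
is comparing utilities. -/
theorem utility_eq_extValue {v : Finset G → ℝ} {p r : G → ℝ} {S W : Finset G}
    (hr : ∀ g, g ∉ S → r g = p g) (h : S ⊆ W) :
    utility v r W = extValue v p S W - bundlePrice r S := by
  have h1 : bundlePrice r W = bundlePrice p (W \ S) + bundlePrice r S := by
    rw [bundlePrice, ← Finset.sum_sdiff h, bundlePrice, bundlePrice]
    congr 1
    exact Finset.sum_congr rfl fun g hg => hr g (Finset.mem_sdiff.1 hg).2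
  rw [utility, extValue, h1]
  ring

theorem extValue_self (v : Finset G → ℝ) (p : G → ℝ) (S : Finset G) : extValue v p S S = v S := by
  simp [extValue, bundlePrice]

/-- Some demanded bundle contains `S`. It is either `S`, which `W` matches by the bidding condition,
or a strict extension, which `W` matches by optimality. -/
theorem bestExtension_mem_demand {v : Finset G → ℝ} {p r : G → ℝ} {S S₀ W : Finset G}
    (hr : ∀ g, g ∉ S → r g = p g) (hS₀ : S₀ ∈ demand v r) (hS : S ⊆ S₀)
    (hW : W ∈ bestExtensions v p S) (hbid : v S ≤ extValue v p S W) : W ∈ demand v r := by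
  intro S'
  refine (hS₀ S').trans ?_
  rw [utility_eq_extValue hr hS, utility_eq_extValue hr hW.1.subset]
  rcases hS.eq_or_ssubset with rfl | hss
  · rw [extValue_self]; linarith
  · linarith [hW.2 S₀ hss]

theorem price_le_one_of_mem_demand {v : Finset G → ℝ} {r : G → ℝ} {W : Finset G}
    (hv : ∀ S, v S ∈ Set.Icc (0 : ℝ) 1) (hW : W ∈ demand v r) {g : G} (hg : g ∈ W) : r g ≤ 1 := by
  have h := hW (W.erase g)
  have h1 : bundlePrice r W = r g + bundlePrice r (W.erase g) :=
    (Finset.add_sum_erase W r hg).symm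
  rw [utility, utility, h1] at h
  linarith [(hv W).2, (hv (W.erase g)).1]

/-- The mark of the new good is the current count, whose quotient by `D` has the current level as
floor: buying freezes the price without changing it. -/
theorem heldPrice_addGood (hR : Regular M P z e N) (hC : CountInv M P z e st) {i : Fin n} {g : G}
    (hg : g ∉ st.bundle i) (i' : Fin n) :
    heldPrice M P (addGood M z st i g) i' = heldPrice M P st i' := by
  funext g'
  by_cases hq : i' = i ∧ g' = g
  · obtain ⟨rfl, rfl⟩ := hq
    rw [heldPrice, heldPrice, if_pos (mem_addGood.2 (Or.inl ⟨rfl, rfl⟩)), if_neg hg,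
      addGood_mark_self, hC.floor_count hR.supply_pos, price]
  · rw [heldPrice, heldPrice, addGood_mark_of_ne hq]
    have : g' ∈ (addGood M z st i g).bundle i' ↔ g' ∈ st.bundle i' := by
      rw [mem_addGood]; tauto
    simp only [this]
    rfl

end demand

end PAlloc

namespace PAlloc

variable {n k : ℕ} {G : Type*}
variable {M : Market n k G} {P : PAllocParams} {z : Option (Fin k) → ℕ → ℝ} {e : ℝ} {N : ℕ}
  {st st' : AuctionState n k G}

/-! ### Turns, reports and rounds -/

theorem price_mono (hP : 0 < P.incr) (hl : ∀ j, st.level j ≤ st'.level j) (g : G) :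
    price M P st g ≤ price M P st' g :=
  mul_le_mul_of_nonneg_left (by exact_mod_cast hl _) hP.le

/-- The total number of bids so far. -/
def totalBids (st : AuctionState n k G) : ℝ := ∑ j, bidCount st j

/-- The total number of goods held. -/
def totalHeld (st : AuctionState n k G) : ℝ := ∑ i, ((st.bundle i).card : ℝ)

theorem totalBids_bid_none : totalBids (bid M P z st none) = totalBids st :=
  Finset.sum_congr rfl fun j _ => by rw [bidCount_bid]; simp

theorem totalBids_bid_some (j : Fin k) :
    totalBids (bid M P z st (some j)) = totalBids st + 1 := by
  classical
  simp only [totalBids, bidCount_bid, Finset.sum_add_distrib, Option.some_inj]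
  simp

theorem totalHeld_sub {i : Fin n} (h : ∀ i' ≠ i, st'.bundle i' = st.bundle i') :
    totalHeld st' - totalHeld st = (st'.bundle i).card - (st.bundle i).card := by
  rw [totalHeld, totalHeld, ← Finset.sum_sub_distrib,
    Finset.sum_eq_single i (fun i' _ hi => by rw [h i' hi, sub_self]) (by simp)]

variable [DecidableEq G]

theorem Inv.floor_le (h : Inv M P z e st) (hR : Regular M P z e N) (i : Fin n) (g : G)
    (hg : g ∈ st.bundle i) : ⌊st.mark i g / effSupply M P⌋₊ ≤ st.level (M.kind g) := by
  obtain ⟨idx, hidx⟩ := h.held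
  exact h.counts.floor_le hR.supply_pos (hidx.mark_le i g hg)

theorem Inv.dropOutbid (hR : Regular M P z e N) (h : Inv M P z e st) (i : Fin n) :
    Inv M P z e (dropOutbid M P z st i) := by
  obtain ⟨idx, hidx⟩ := h.held
  exact ⟨h.counts.congr rfl rfl rfl, ⟨idx, hidx.dropOutbid i⟩,
    h.demanded.of_drop_of_raise hR (h.floor_le hR) (dropOutbid_subset i) rfl fun _ => le_rfl⟩

theorem Inv.bid_none (hR : Regular M P z e N) (h : Inv M P z e st) (hN : st.clock + 1 ≤ N) :
    Inv M P z e (bid M P z st none) := by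
  obtain ⟨idx, hidx⟩ := h.held
  exact ⟨h.counts.bid hR hN none (by simp), ⟨idx, hidx.bid_none⟩,
    h.demanded.of_drop_of_raise hR (h.floor_le hR) (fun _ => subset_rfl) rfl
      (level_le_level_bid none)⟩

theorem Inv.bid_addGood (hR : Regular M P z e N) (h : Inv M P z e st) (hN : st.clock + 1 ≤ N)
    {i : Fin n} {W : Finset G} {g : G}
    (hW : W ∈ bestExtensions (M.val i) (price M P st) (st.bundle i))
    (hbid : M.val i (st.bundle i) ≤ extValue (M.val i) (price M P st) (st.bundle i) W)
    (hg : g ∈ W \ st.bundle i) :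
    Inv M P z e (bid M P z (addGood M z st i g) (some (M.kind g))) := by
  obtain ⟨hgW, hgS⟩ := Finset.mem_sdiff.1 hg
  have hheld : ∀ g', g' ∉ st.bundle i → heldPrice M P st i g' = price M P st g' :=
    fun g' hg' => if_neg hg'
  have hWd : W ∈ demand (M.val i) (heldPrice M P st i) := by
    obtain ⟨S₀, hS₀, hS⟩ := h.demanded i
    exact bestExtension_mem_demand hheld hS₀ hS hW hbid
  have hp : price M P st g ≤ 1 := by
    rw [← hheld g hgS]
    exact price_le_one_of_mem_demand (hR.val_mem i) hWd hgW
  have hC : CountInv M P z e (addGood M z st i g) := h.counts.congr rfl rfl rfl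
  have hD : DemandInv M P (addGood M z st i g) := by
    intro i'
    rw [heldPrice_addGood hR h.counts hgS]
    by_cases hi : i' = i
    · subst hi
      refine ⟨W, hWd, fun g' hg' => ?_⟩
      rcases mem_addGood.1 hg' with ⟨_, rfl⟩ | h'
      · exact hgW
      · exact hW.1.subset h'
    · rw [addGood_bundle_of_ne hi]
      exact h.demanded i'
  have hfloor : ∀ i', ∀ g' ∈ (addGood M z st i g).bundle i',
      ⌊(addGood M z st i g).mark i' g' / effSupply M P⌋₊ ≤
        (addGood M z st i g).level (M.kind g') := by
    intro i' g' hg'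
    by_cases hq : i' = i ∧ g' = g
    · obtain ⟨rfl, rfl⟩ := hq
      rw [addGood_mark_self]
      exact h.counts.floor_le hR.supply_pos le_rfl
    · rw [addGood_mark_of_ne hq]
      exact h.floor_le hR i' g' ((mem_addGood.1 hg').resolve_left hq)
  obtain ⟨idx, hidx⟩ := h.held
  refine ⟨hC.bid hR hN _ ?_, hidx.bid_addGood hR h.counts (by omega) hgS,
    hD.of_drop_of_raise hR hfloor (fun _ => subset_rfl) rfl (level_le_level_bid _)⟩
  intro j hj
  obtain rfl : M.kind g = j := by simpa using hj
  exact hp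

/-- Whether bidder `i` wants to bid in the state `st`. -/
def Wants (M : Market n k G) (P : PAllocParams) (st : AuctionState n k G) (i : Fin n) : Prop :=
  WantsToBid (M.val i) (price M P st) (st.bundle i)

open scoped Classical in
/-- The indicator of `Wants`. -/
def wants (M : Market n k G) (P : PAllocParams) (st : AuctionState n k G) (i : Fin n) : ℝ :=
  if Wants M P st i then 1 else 0

theorem wants_nonneg (i : Fin n) : 0 ≤ wants M P st i := by
  rw [wants]; split_ifs <;> norm_num

theorem wants_le_one (i : Fin n) : wants M P st i ≤ 1 := by
  rw [wants]; split_ifs <;> norm_num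

theorem extValue_antitone {v : Finset G → ℝ} {p p' : G → ℝ} (h : ∀ g, p g ≤ p' g)
    (S W : Finset G) : extValue v p' S W ≤ extValue v p S W :=
  sub_le_sub_left (Finset.sum_le_sum fun g _ => h g) _

theorem wants_antitone (hP : 0 < P.incr) (hl : ∀ j, st.level j ≤ st'.level j) {i : Fin n}
    (hb : st'.bundle i = st.bundle i) : wants M P st' i ≤ wants M P st i := by
  by_cases h : Wants M P st' i
  · have : Wants M P st i := by
      obtain ⟨W, hW, hv⟩ := h
      rw [hb] at hW hv
      exact ⟨W, hW, hv.trans (extValue_antitone (price_mono hP hl) _ _)⟩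
    rw [wants, wants, if_pos h, if_pos this]
  · rw [wants, if_neg h]
    exact wants_nonneg i

section turn

variable [Fintype G] {ch : ChoiceRule M P}

/-- The effect of the turns of some bidders, on the state and on the number of bids. -/
structure TurnSpec (M : Market n k G) (P : PAllocParams) (z : Option (Fin k) → ℕ → ℝ) (e : ℝ)
    (st st' : AuctionState n k G) (l : List (Fin n)) : Prop where
  inv : Inv M P z e st'
  clock : st'.clock = st.clock + l.length
  repClock : st'.repClock = st.repClock
  reports : st'.reports = st.reports
  level_le : ∀ j, st.level j ≤ st'.level j
  bundle_eq : ∀ i ∉ l, st'.bundle i = st.bundle i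
  potential : totalHeld st' + (l.map (wants M P st')).sum ≤
    totalHeld st + 2 * (totalBids st' - totalBids st)

/-- A bid pays 2: one for the good added and one for a possible wish to continue. Without a bid the
best extension was not good enough, so the bidder does not want to bid, and price raises keep it so.
-/
theorem turnSpec_turn (hR : Regular M P z e N) (h : Inv M P z e st) (hN : st.clock + 1 ≤ N)
    (i : Fin n) : TurnSpec M P z e st (turn M P z ch st i) [i] := by
  classical
  have h₁ := h.dropOutbid hR i
  set st₁ := dropOutbid M P z st i with hst₁
  have hturn : turn M P z ch st i = if st₁.bundle i ≠ Finset.univ ∧ M.val i (st₁.bundle i) ≤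
      extValue (M.val i) (price M P st₁) (st₁.bundle i) (ch.pick st₁ i).1 then
      bid M P z (addGood M z st₁ i (ch.pick st₁ i).2) (some (M.kind (ch.pick st₁ i).2))
    else bid M P z st₁ none := by
    simp only [turn, ← hst₁]
    congr
  have hsub : st₁.bundle i ⊆ st.bundle i := dropOutbid_subset i i
  have hcard : ((st₁.bundle i).card : ℝ) ≤ (st.bundle i).card := by
    exact_mod_cast Finset.card_le_card hsub
  have hne : ∀ i' ≠ i, st₁.bundle i' = st.bundle i' := fun i' hi => dropOutbid_bundle_of_ne hi
  by_cases hc : st₁.bundle i ≠ Finset.univ ∧ M.val i (st₁.bundle i) ≤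
      extValue (M.val i) (price M P st₁) (st₁.bundle i) (ch.pick st₁ i).1
  · rw [if_pos hc] at hturn
    rw [hturn]
    have hgood := ch.pick_good st₁ i hc.1
    set g := (ch.pick st₁ i).2
    have hne' : ∀ i' ≠ i, (bid M P z (addGood M z st₁ i g) (some (M.kind g))).bundle i' =
        st.bundle i' := fun i' hi =>
      (addGood_bundle_of_ne (M := M) (z := z) hi).trans (hne i' hi)
    refine ⟨h₁.bid_addGood hR hN (ch.pick_best st₁ i hc.1) hc.2 hgood, rfl, rfl, rfl,
      level_le_level_bid (st := addGood M z st₁ i g) _,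
      fun i' hi => hne' i' (by simpa using hi), ?_⟩
    have h2 := totalHeld_sub hne'
    have h3 : (bid M P z (addGood M z st₁ i g) (some (M.kind g))).bundle i =
        insert g (st₁.bundle i) := by simp [bid, addGood]
    have h4 : ((insert g (st₁.bundle i)).card : ℝ) ≤ (st₁.bundle i).card + 1 := by
      exact_mod_cast Finset.card_insert_le _ _
    have h5 : totalBids (bid M P z (addGood M z st₁ i g) (some (M.kind g))) = totalBids st + 1 :=
      totalBids_bid_some _
    have h6 := wants_le_one (M := M) (P := P)
      (st := bid M P z (addGood M z st₁ i g) (some (M.kind g))) i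
    rw [h3] at h2
    simp only [List.map_cons, List.map_nil, List.sum_cons, List.sum_nil]
    linarith
  · rw [if_neg hc] at hturn
    rw [hturn]
    refine ⟨h₁.bid_none hR hN, rfl, rfl, rfl, level_le_level_bid (st := st₁) none,
      fun i' hi => hne i' (by simpa using hi), ?_⟩
    have h2 := totalHeld_sub (st := st) (st' := bid M P z st₁ none) (i := i) hne
    have h3 : (bid M P z st₁ none).bundle i = st₁.bundle i := rfl
    have h5 : totalBids (bid M P z st₁ none) = totalBids st := totalBids_bid_none
    have h6 : wants M P st₁ i = 0 := by
      refine if_neg ?_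
      rintro ⟨W, hW, hv⟩
      have hu : st₁.bundle i ≠ Finset.univ := by
        intro hu
        rw [hu] at hW
        exact hW.2 (Finset.subset_univ W)
      exact hc ⟨hu, hv.trans ((ch.pick_best st₁ i hu).2 W hW)⟩
    have h7 := wants_antitone (M := M) hR.incr_pos (level_le_level_bid (st := st₁) none)
      (i := i) h3
    rw [h3] at h2
    simp only [List.map_cons, List.map_nil, List.sum_cons, List.sum_nil]
    linarith

/-- Later turns leave the bundles of earlier bidders alone and only raise prices, so the wish to bid
cannot reappear before the reports. -/
theorem turnSpec_foldl (hR : Regular M P z e N) (h : Inv M P z e st) (l : List (Fin n))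
    (hl : l.Nodup) (hN : st.clock + l.length ≤ N) :
    TurnSpec M P z e st (l.foldl (turn M P z ch) st) l := by
  induction l using List.reverseRecOn with
  | nil => exact ⟨h, rfl, rfl, rfl, fun _ => le_rfl, fun _ _ => rfl, by simp⟩
  | append_singleton l i ih =>
    rw [List.foldl_append, List.foldl_cons, List.foldl_nil]
    rw [List.length_append, List.length_singleton] at hN
    have hnd := List.nodup_append.1 hl
    have hi : i ∉ l := fun hi => hnd.2.2 i hi i (by simp) rfl
    have h₁ := ih hnd.1 (by omega)
    set st₁ := l.foldl (turn M P z ch) st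
    have h₂ := turnSpec_turn (ch := ch) hR h₁.inv (by rw [h₁.clock]; omega) i
    set st₂ := turn M P z ch st₁ i
    refine ⟨h₂.inv, ?_, h₂.repClock.trans h₁.repClock, h₂.reports.trans h₁.reports,
      fun j => (h₁.level_le j).trans (h₂.level_le j), fun i' hi' => ?_, ?_⟩
    · rw [h₂.clock, h₁.clock, List.length_append, List.length_singleton, add_assoc]
    · simp only [List.mem_append, List.mem_singleton, not_or] at hi'
      rw [h₂.bundle_eq i' (by simpa using hi'.2), h₁.bundle_eq i' hi'.1]
    · have hsum : (l.map (wants M P st₂)).sum ≤ (l.map (wants M P st₁)).sum := by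
        refine List.sum_le_sum fun i' hi' => wants_antitone hR.incr_pos h₂.level_le ?_
        exact h₂.bundle_eq i' (by rw [List.mem_singleton]; rintro rfl; exact hi hi')
      have p₁ := h₁.potential
      have p₂ := h₂.potential
      simp only [List.map_cons, List.map_nil, List.sum_cons, List.sum_nil] at p₂
      rw [List.map_append, List.sum_append]
      simp only [List.map_cons, List.map_nil, List.sum_cons, List.sum_nil]
      linarith

end turn

/-- The effect of the reports of some bidders. -/
structure ReportSpec (M : Market n k G) (P : PAllocParams) (z : Option (Fin k) → ℕ → ℝ) (e : ℝ)
    (st st' : AuctionState n k G) (l : List (Fin n)) : Prop where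
  inv : Inv M P z e st'
  clock : st'.clock = st.clock
  bids : st'.bids = st.bids
  level : st'.level = st.level
  repClock : st'.repClock = st.repClock + l.length
  reports_nonneg : ∀ u, 0 ≤ st'.reports u
  bundle_eq : ∀ i ∉ l, st'.bundle i = st.bundle i
  not_outbid : ∀ i ∈ l, ∀ g ∈ st'.bundle i,
    count z st' (M.kind g) - st'.mark i g < effSupply M P
  repCount_eq : repCount st' = repCount st + (l.map (wants M P st')).sum
  potential : totalHeld st' + (l.map (wants M P st')).sum ≤
    totalHeld st + (l.map (wants M P st)).sum

theorem Inv.congr (h : Inv M P z e st) (h1 : st'.bundle = st.bundle) (h2 : st'.mark = st.mark)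
    (h3 : st'.level = st.level) (h4 : st'.clock = st.clock) (h5 : st'.bids = st.bids) :
    Inv M P z e st' := by
  cases st; cases st'
  subst h1 h2 h3 h4 h5
  obtain ⟨hC, ⟨idx, hH⟩, hD⟩ := h
  exact ⟨⟨hC.1, hC.2, hC.3, hC.4, hC.5⟩, ⟨idx, hH.1, hH.2, hH.3, hH.4, hH.5⟩, hD⟩

theorem wants_congr {i : Fin n} (hb : st'.bundle i = st.bundle i) (hl : st'.level = st.level) :
    wants M P st' i = wants M P st i := by
  have hp : price M P st' = price M P st := by funext g; rw [price, price, hl]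
  have hw : Wants M P st' i ↔ Wants M P st i := by rw [Wants, Wants, hb, hp]
  unfold wants
  split_ifs <;> tauto

/-- The wish to bid can newly arise only if a good is dropped, and then the decrease of the goods
held pays for it. -/
theorem reportSpec_report (hR : Regular M P z e N) (h : Inv M P z e st)
    (hrep : ∀ u, 0 ≤ st.reports u) (i : Fin n) :
    ReportSpec M P z e st (report M P z st i) [i] := by
  classical
  have h₁ := h.dropOutbid hR i
  have hne : ∀ i' ≠ i, (report M P z st i).bundle i' = st.bundle i' :=
    fun i' hi => dropOutbid_bundle_of_ne hi
  refine ⟨h₁.congr rfl rfl rfl rfl rfl, rfl, rfl, rfl, rfl, fun u => ?_,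
    fun i' hi => hne i' (by simpa using hi), fun i' hi' g hg => ?_, ?_, ?_⟩
  · simp only [report, Function.update_apply]
    split_ifs
    · exact zero_le_one
    · exact le_rfl
    · exact hrep u
  · obtain rfl : i' = i := by simpa using hi'
    exact (mem_dropOutbid.1 hg).2 rfl
  · simp only [List.map_cons, List.map_nil, List.sum_cons, List.sum_nil, add_zero]
    refine (streamCount_update _ _ _).trans ?_
    congr 1
    refine if_congr ?_ rfl rfl
    change _ ↔ WantsToBid (M.val i) (price M P (dropOutbid M P z st i))
      ((dropOutbid M P z st i).bundle i)
    convert Iff.rfl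
  · have h2 := totalHeld_sub hne
    simp only [List.map_cons, List.map_nil, List.sum_cons, List.sum_nil, add_zero]
    have hsub : (report M P z st i).bundle i ⊆ st.bundle i := dropOutbid_subset i i
    rcases hsub.eq_or_ssubset with heq | hss
    · rw [wants_congr (st := st) heq rfl]
      rw [heq] at h2
      linarith
    · have h3 : (((report M P z st i).bundle i).card : ℝ) + 1 ≤ (st.bundle i).card := by
        exact_mod_cast Finset.card_lt_card hss
      linarith [wants_le_one (M := M) (P := P) (st := report M P z st i) i,
        wants_nonneg (M := M) (P := P) (st := st) i]

theorem reportSpec_foldl (hR : Regular M P z e N) (h : Inv M P z e st)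
    (hrep : ∀ u, 0 ≤ st.reports u) (l : List (Fin n)) (hl : l.Nodup) :
    ReportSpec M P z e st (l.foldl (report M P z) st) l := by
  induction l using List.reverseRecOn with
  | nil => exact ⟨h, rfl, rfl, rfl, rfl, hrep, fun _ _ => rfl, by simp, by simp, by simp⟩
  | append_singleton l i ih =>
    rw [List.foldl_append, List.foldl_cons, List.foldl_nil]
    have hnd := List.nodup_append.1 hl
    have hi : i ∉ l := fun hi => hnd.2.2 i hi i (by simp) rfl
    have h₁ := ih hnd.1
    have hmark : (l.foldl (report M P z) st).mark =
        (report M P z (l.foldl (report M P z) st) i).mark := rfl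
    set st₁ := l.foldl (report M P z) st
    have h₂ := reportSpec_report hR h₁.inv h₁.reports_nonneg i
    set st₂ := report M P z st₁ i
    have hb : ∀ i' ∈ l, st₂.bundle i' = st₁.bundle i' := fun i' hi' =>
      h₂.bundle_eq i' (by rw [List.mem_singleton]; rintro rfl; exact hi hi')
    have hsum : l.map (wants M P st₂) = l.map (wants M P st₁) :=
      List.map_congr_left fun i' hi' => wants_congr (hb i' hi') h₂.level
    have hwi : wants M P st₁ i = wants M P st i := wants_congr (h₁.bundle_eq i hi) h₁.level
    have r₁ := h₁.repCount_eq
    have r₂ := h₂.repCount_eq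
    have p₁ := h₁.potential
    have p₂ := h₂.potential
    simp only [List.map_cons, List.map_nil, List.sum_cons, List.sum_nil, add_zero] at r₂ p₂
    refine ⟨h₂.inv, h₂.clock.trans h₁.clock, h₂.bids.trans h₁.bids, h₂.level.trans h₁.level, ?_,
      h₂.reports_nonneg, fun i' hi' => ?_, fun i' hi' g hg => ?_, ?_, ?_⟩
    · rw [h₂.repClock, h₁.repClock, List.length_append, List.length_singleton, add_assoc]
    · simp only [List.mem_append, List.mem_singleton, not_or] at hi'
      rw [h₂.bundle_eq i' (by simpa using hi'.2), h₁.bundle_eq i' hi'.1]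
    · rcases List.mem_append.1 hi' with hi' | hi'
      · rw [hb i' hi'] at hg
        have h3 := h₁.not_outbid i' hi' g hg
        rw [hmark] at h3
        exact h3
      · exact h₂.not_outbid i' hi' g hg
    · rw [List.map_append, List.sum_append, hsum, r₂, r₁]
      simp [add_assoc]
    · rw [List.map_append, List.sum_append, List.map_append, List.sum_append, hsum]
      simp only [List.map_cons, List.map_nil, List.sum_cons, List.sum_nil, add_zero]
      linarith

end PAlloc

namespace PAlloc

variable {n k : ℕ} {G : Type*}
variable {M : Market n k G} {P : PAllocParams} {z : Option (Fin k) → ℕ → ℝ} {e : ℝ} {N : ℕ}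
  {st : AuctionState n k G}

/-! ### The run of the auction -/

theorem abs_count0_sub_le (hz : Accurate z e N) (hrep : ∀ u, 0 ≤ st.reports u)
    (hN : st.repClock ≤ N) : |count0 z st - repCount st| ≤ e :=
  abs_counter_sub_le hrep fun u hu => hz _ u (hu.trans hN)

theorem totalBids_le (hR : Regular M P z e N) (h : CountInv M P z e st) :
    totalBids st ≤ k * ((1 / P.incr + 1) * effSupply M P + e + 1) := by
  have hj : ∀ j ∈ (Finset.univ : Finset (Fin k)),
      bidCount st j ≤ (1 / P.incr + 1) * effSupply M P + e + 1 := by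
    intro j _
    obtain ⟨l, hl, hlt⟩ := h.bidCount_lt j
    have h1 : (l : ℝ) ≤ 1 / P.incr := by rw [le_div_iff₀ hR.incr_pos]; linarith
    have h2 : ((l : ℝ) + 1) * effSupply M P ≤ (1 / P.incr + 1) * effSupply M P :=
      mul_le_mul_of_nonneg_right (by linarith) hR.supply_pos.le
    linarith
  refine (Finset.sum_le_card_nsmul _ _ _ hj).trans (le_of_eq ?_)
  rw [Finset.card_univ, Fintype.card_fin, nsmul_eq_mul]

/-- The number of goods of type `j` that are handed out. -/
def heldCount (M : Market n k G) (st : AuctionState n k G) (j : Fin k) : ℕ :=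
  ∑ i, ((st.bundle i).filter fun g => M.kind g = j).card

theorem heldCount_eq_card_image {idx : Fin n → G → ℕ} (h : HeldInv M P z e st idx) (j : Fin k) :
    heldCount M st j = ((Finset.univ.sigma fun i => (st.bundle i).filter fun g =>
      M.kind g = j).image fun q => idx q.1 q.2).card := by
  rw [Finset.card_image_of_injOn, Finset.card_sigma, heldCount]
  rintro ⟨i, g⟩ hg ⟨i', g'⟩ hg' heq
  simp only [Finset.coe_sigma, Set.mem_sigma_iff, Finset.coe_filter, Finset.mem_coe,
    Finset.mem_univ, true_and] at hg hg'
  obtain ⟨rfl, rfl⟩ := h.inj i g hg.1 i' g' hg'.1 (hg.2.trans hg'.2.symm) heq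
  rfl

/-- The last bid was made at a price at most 1; since `2 e + 1 < D`, the count has passed at most
one further threshold. -/
theorem price_sub_incr_le_one (hR : Regular M P z e N) (h : CountInv M P z e st)
    (hN : st.clock ≤ N) (j : Fin k) : P.incr * st.level j - P.incr ≤ 1 := by
  obtain ⟨l, hl, hlt⟩ := h.bidCount_lt j
  have hacc := (abs_le.1 (h.abs_count_sub_le hR.accurate hN j)).2
  have hD := hR.supply_pos
  have h1 : (st.level j : ℝ) * effSupply M P < ((l : ℝ) + 2) * effSupply M P := by
    linarith [h.level_le j, hR.err_lt]
  have h2 : (st.level j : ℝ) < ((l + 2 : ℕ) : ℝ) := by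
    push_cast
    exact lt_of_mul_lt_mul_right h1 hD.le
  have h3 : (st.level j : ℝ) ≤ l + 1 := by
    exact_mod_cast Nat.lt_succ_iff.1 (Nat.cast_lt.1 h2)
  nlinarith [hR.incr_pos]

theorem sum_kind_eq_heldCount (f : Fin k → ℝ) :
    ∑ i, ∑ g ∈ st.bundle i, f (M.kind g) = ∑ j, heldCount M st j * f j := by
  have h1 : ∀ i, ∑ g ∈ st.bundle i, f (M.kind g) =
      ∑ j, (((st.bundle i).filter fun g => M.kind g = j).card : ℝ) * f j := by
    intro i
    rw [← Finset.sum_fiberwise (st.bundle i) M.kind]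
    refine Finset.sum_congr rfl fun j _ => ?_
    rw [Finset.sum_congr rfl fun g hg => by rw [(Finset.mem_filter.1 hg).2], Finset.sum_const,
      nsmul_eq_mul]
  simp_rw [h1]
  rw [Finset.sum_comm]
  refine Finset.sum_congr rfl fun j _ => ?_
  rw [← Finset.sum_mul, heldCount]
  push_cast
  rfl

variable [DecidableEq G]

/-- The last `⌊D - 2 e - 1⌋` bids are too recent to have been outbid, so `surj` gives each its own
held copy. A positive level guarantees enough bids if there are fewer than that many. -/
theorem le_heldCount (hR : Regular M P z e N) (h : Inv M P z e st) (hN : st.clock ≤ N)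
    {j : Fin k} (hj : 1 ≤ st.level j) :
    effSupply M P - 2 * e - 2 ≤ (heldCount M st j : ℝ) := by
  obtain ⟨idx, hH⟩ := h.held
  obtain ⟨C, hC⟩ := h.counts.exists_nat j
  have hacc := (abs_le.1 (h.counts.abs_count_sub_le hR.accurate hN j)).2
  rw [hC] at hacc
  have hD := hR.supply_pos
  have he := hR.err_nonneg
  set m₁ := ⌊effSupply M P - 2 * e - 1⌋₊
  have hm₁ : (m₁ : ℝ) ≤ effSupply M P - 2 * e - 1 := Nat.floor_le (by linarith [hR.err_lt])
  have hsub : Finset.Ico (C - m₁) C ⊆ ((Finset.univ.sigma fun i => (st.bundle i).filter fun g =>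
      M.kind g = j).image fun q => idx q.1 q.2) := by
    intro b hb
    obtain ⟨hb1, hb2⟩ := Finset.mem_Ico.1 hb
    have h1 : (C : ℝ) ≤ b + m₁ := by exact_mod_cast (by omega : C ≤ b + m₁)
    rcases hH.surj j b (by rw [hC]; exact_mod_cast hb2) with ⟨i, g, hg, hk, hi⟩ | h'
    · exact Finset.mem_image.2 ⟨⟨i, g⟩, by simp [hg, hk], hi⟩
    · exfalso
      linarith
  have hcard := Finset.card_le_card hsub
  rw [← heldCount_eq_card_image hH, Nat.card_Ico] at hcard
  have hmin : m₁ ≤ heldCount M st j ∨ C ≤ heldCount M st j := by omega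
  rcases hmin with hmin | hmin
  · have h1 : (m₁ : ℝ) ≤ heldCount M st j := by exact_mod_cast hmin
    have h2 := Nat.lt_floor_add_one (effSupply M P - 2 * e - 1)
    linarith
  · have h1 : (C : ℝ) ≤ heldCount M st j := by exact_mod_cast hmin
    have h2 := h.counts.level_le j
    have h3 : (1 : ℝ) ≤ st.level j := by exact_mod_cast hj
    nlinarith

/-- A bidder who does not want to bid holds a demanded bundle at held prices, which never exceed
current ones. For one who does, the slack 1 covers any value, provided her own utility is
nonnegative. -/
theorem value_le_of_inv (hR : Regular M P z e N) (h : Inv M P z e st) (i : Fin n) (S : Finset G) :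
    M.val i S - bundlePrice (price M P st) S ≤
      M.val i (st.bundle i) - bundlePrice (heldPrice M P st i) (st.bundle i) + wants M P st i := by
  classical
  set r := heldPrice M P st i with hr
  set b := st.bundle i with hb
  have hrp : ∀ g, g ∉ b → r g = price M P st g := fun g hg => if_neg hg
  have hr0 : ∀ g, 0 ≤ r g := heldPrice_nonneg hR.incr_pos i
  obtain ⟨S₁, hS₁, hsub⟩ := h.demanded i
  by_cases hw : Wants M P st i
  · have hw1 : wants M P st i = 1 := if_pos hw
    have hval : 0 ≤ M.val i b - bundlePrice r b := by
      -- A surcharge of 2 on all goods outside `b` exceeds any gain in value, so the demanded bundle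
      -- supplied by gross substitutes is `b` itself; comparing it with the empty bundle gives the
      -- sign.
      obtain ⟨S₂, hS₂, hbS₂⟩ := hR.substitutes i r (fun g => if g ∈ b then r g else r g + 2) hr0
        (fun g => by split_ifs <;> linarith) S₁ hS₁ b hsub (fun g hg => if_pos hg)
      set p' : G → ℝ := fun g => if g ∈ b then r g else r g + 2
      have hp'b : bundlePrice p' b = bundlePrice r b :=
        Finset.sum_congr rfl fun g hg => if_pos hg
      have heq : S₂ = b := by
        by_contra hne
        obtain ⟨g, hgS, hgb⟩ := Finset.exists_of_ssubset (hbS₂.ssubset_of_ne (Ne.symm hne))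
        have h1 := hS₂ b
        have h2 : bundlePrice p' S₂ = bundlePrice p' (S₂ \ b) + bundlePrice p' b :=
          (Finset.sum_sdiff hbS₂).symm
        have h3 : p' g ≤ bundlePrice p' (S₂ \ b) :=
          Finset.single_le_sum (f := p') (fun g' _ => by
            simp only [p']; split_ifs <;> linarith [hr0 g']) (Finset.mem_sdiff.2 ⟨hgS, hgb⟩)
        have h4 : p' g = r g + 2 := if_neg hgb
        rw [utility, utility] at h1
        linarith [(hR.val_mem i S₂).2, (hR.val_mem i b).1, hr0 g]
      have h1 := hS₂ ∅
      rw [heq, utility, utility, hp'b] at h1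
      simp only [bundlePrice, Finset.sum_empty] at h1 ⊢
      linarith [(hR.val_mem i ∅).1]
    have hS : 0 ≤ bundlePrice (price M P st) S :=
      Finset.sum_nonneg fun g _ => price_nonneg hR.incr_pos g
    linarith [(hR.val_mem i S).2]
  · have hbd : utility (M.val i) r S ≤ utility (M.val i) r b := by
      rcases hsub.eq_or_ssubset with heq | hss
      · rw [hb, heq]; exact hS₁ S
      · refine (hS₁ S).trans ?_
        rw [utility_eq_extValue hrp hss.subset, utility_eq_extValue hrp subset_rfl, extValue_self]
        have : extValue (M.val i) (price M P st) b S₁ < M.val i b := by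
          by_contra hle
          exact hw ⟨S₁, hss, not_lt.1 hle⟩
        linarith
    have hle : bundlePrice r S ≤ bundlePrice (price M P st) S := by
      refine Finset.sum_le_sum fun g _ => ?_
      by_cases hg : g ∈ b
      · rw [hr, heldPrice, if_pos hg]
        exact mul_le_mul_of_nonneg_left (by exact_mod_cast h.floor_le hR i g hg) hR.incr_pos.le
      · rw [hrp g hg]
    rw [utility, utility] at hbd
    linarith [wants_nonneg (M := M) (P := P) (st := st) i]

variable [Fintype G]

theorem Inv.init (hR : Regular M P z e N) : Inv M P z e (init : AuctionState n k G) := by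
  have hD := hR.supply_pos
  have hbid : ∀ j, bidCount (PAlloc.init : AuctionState n k G) j = 0 := fun j => by
    simp [bidCount, PAlloc.init, streamCount]
  have hcount : ∀ j, count z (PAlloc.init : AuctionState n k G) j = 0 := fun j => by
    simp [count, PAlloc.init, counter, binaryMechanism]
  refine ⟨⟨fun j u => le_rfl, fun j => ⟨0, by simp [hbid]⟩, fun j => ?_, fun j => ?_, fun j => ?_⟩,
    ⟨fun _ _ => 0, ⟨?_, ?_, ?_, ?_, ?_⟩⟩, fun i => ?_⟩
  · rw [hcount]; simp [PAlloc.init]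
  · rw [hcount]; simp [PAlloc.init, hD]
  · refine ⟨0, by simp, ?_⟩
    rw [hbid]
    push_cast
    linarith [hR.err_nonneg]
  · intro i g hg; simp [PAlloc.init] at hg
  · intro i g hg; simp [PAlloc.init] at hg
  · intro i g hg; simp [PAlloc.init] at hg
  · intro i g hg; simp [PAlloc.init] at hg
  · intro j b hb
    rw [hbid] at hb
    exact absurd hb (by simp)
  · obtain ⟨S, hS⟩ := Finite.exists_max (utility (M.val i) (heldPrice M P PAlloc.init i))
    exact ⟨S, hS, by simp [PAlloc.init]⟩

/-- Nobody holds a good for which she has been outbid, and few bidders want to continue. -/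
structure Settled (M : Market n k G) (P : PAllocParams) (z : Option (Fin k) → ℕ → ℝ)
    (st : AuctionState n k G) : Prop where
  not_outbid : ∀ i, ∀ g ∈ st.bundle i, count z st (M.kind g) - st.mark i g < effSupply M P
  sum_wants_lt : ∑ i, wants M P st i < P.rho * Fintype.card G

structure RunInv (M : Market n k G) (P : PAllocParams) (z : Option (Fin k) → ℕ → ℝ) (e : ℝ)
    (st : AuctionState n k G) (r : ℕ) : Prop where
  inv : Inv M P z e st
  clock_le : st.clock ≤ n * r
  repClock_le : st.repClock ≤ n * r
  reports_nonneg : ∀ u, 0 ≤ st.reports u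
  potential : totalHeld st + repCount st ≤ 2 * totalBids st
  of_not_halted : ¬ st.halted → r * (P.rho * Fintype.card G - 2 * P.E n k) ≤ count0 z st
  of_halted : st.halted → Settled M P z st

theorem runInv_round (hR : Regular M P z e N) (he : e ≤ P.E n k) {ch : ChoiceRule M P} {r : ℕ}
    (h : RunInv M P z e st r) (hh : ¬ st.halted) (hN : n * (r + 1) ≤ N) :
    RunInv M P z e (round M P z ch st) (r + 1) := by
  have hnd : (List.finRange n).Nodup := List.nodup_finRange n
  have hlen : (List.finRange n).length = n := List.length_finRange
  have hNr : n * (r + 1) = n * r + n := by ring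
  have hc := h.clock_le
  have hrc := h.repClock_le
  have hT := turnSpec_foldl (ch := ch) hR h.inv (List.finRange n) hnd (by omega)
  rw [← propose] at hT
  set st₁ := propose M P z ch st
  have hrep₁ : ∀ u, 0 ≤ st₁.reports u := by rw [hT.reports]; exact h.reports_nonneg
  have hQ := reportSpec_foldl hR hT.inv hrep₁ (List.finRange n) hnd
  rw [← countUnsatisfied] at hQ
  have hround : round M P z ch st = { countUnsatisfied M P z st₁ with
      halted := count0 z (countUnsatisfied M P z st₁) - count0 z st <
        P.rho * (Fintype.card G : ℝ) - 2 * P.E n k } := rfl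
  set st₂ := countUnsatisfied M P z st₁
  have hsum : ∀ f : Fin n → ℝ, ((List.finRange n).map f).sum = ∑ i, f i := fun f =>
    (Fin.sum_univ_def f).symm
  have hrep_eq : repCount st₁ = repCount st := by
    rw [repCount, repCount, hT.reports, hT.repClock]
  have hbids : totalBids st₂ = totalBids st₁ := by
    simp only [totalBids, bidCount, hQ.bids, hQ.clock]
  have hclock : st₂.clock ≤ n * (r + 1) := by rw [hQ.clock, hT.clock]; omega
  have hrepClock : st₂.repClock ≤ n * (r + 1) := by rw [hQ.repClock, hT.repClock]; omega
  have hrepCount := hQ.repCount_eq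
  have p₁ := hT.potential
  have p₂ := hQ.potential
  have p₀ := h.potential
  rw [hsum] at hrepCount p₁
  rw [hsum, hsum] at p₂
  have hinv : Inv M P z e (round M P z ch st) := by
    rw [hround]
    exact hQ.inv.congr rfl rfl rfl rfl rfl
  rw [hround] at hinv ⊢
  refine ⟨hinv, hclock, hrepClock, hQ.reports_nonneg, ?_, fun hnh => ?_, fun hhalt => ?_⟩
  · change totalHeld st₂ + repCount st₂ ≤ 2 * totalBids st₂
    linarith
  · have h1 := not_lt.1 hnh
    have h2 := h.of_not_halted hh
    change _ ≤ count0 z st₂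
    push_cast
    linarith
  · change count0 z st₂ - count0 z st < _ at hhalt
    refine ⟨fun i g hg => hQ.not_outbid i (List.mem_finRange i) g hg, ?_⟩
    -- The two readings of `counter(0)` err by at most `2 e ≤ 2 E`, which the halting threshold has
    -- already subtracted.
    have a₁ := abs_le.1 (abs_count0_sub_le hR.accurate h.reports_nonneg (by omega : st.repClock ≤ N))
    have a₂ := abs_le.1 (abs_count0_sub_le hR.accurate hQ.reports_nonneg (hrepClock.trans hN))
    change ∑ i, wants M P st₂ i < _
    linarith

theorem runInv_run (hR : Regular M P z e N) (he : e ≤ P.E n k) {ch : ChoiceRule M P} (r : ℕ)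
    (hN : n * r ≤ N) : RunInv M P z e (run M P z ch r) r := by
  classical
  induction r with
  | zero =>
    refine ⟨Inv.init hR, le_rfl, le_rfl, fun _ => le_rfl, ?_, fun _ => ?_, fun h => h.elim⟩
    · simp [run, init, totalHeld, repCount, totalBids, bidCount, streamCount]
    · simp [run, init, count0, counter, binaryMechanism]
  | succ r ih =>
    have hle : n * r ≤ n * (r + 1) := Nat.mul_le_mul_left n (Nat.le_succ r)
    have h := ih (hle.trans hN)
    rw [run]
    split_ifs with hh
    · exact ⟨h.inv, h.clock_le.trans hle, h.repClock_le.trans hle, h.reports_nonneg, h.potential,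
        fun hn => absurd hh hn, h.of_halted⟩
    · exact runInv_round hR he h hh hN

theorem halted_run (hR : Regular M P z e N) (he : e ≤ P.E n k) {ch : ChoiceRule M P} {r : ℕ}
    (hN : n * r ≤ N)
    (hr : 2 * (k * ((1 / P.incr + 1) * effSupply M P + e + 1)) + e <
      r * (P.rho * Fintype.card G - 2 * P.E n k)) :
    (run M P z ch r).halted := by
  by_contra hh
  have h := runInv_run (ch := ch) hR he r hN
  have h1 := h.of_not_halted hh
  have h2 := (abs_le.1 (abs_count0_sub_le hR.accurate h.reports_nonneg
    (h.repClock_le.trans hN))).2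
  have h3 := h.potential
  have h4 := totalBids_le hR h.inv.counts
  have h5 : 0 ≤ totalHeld (run M P z ch r) := Finset.sum_nonneg fun _ _ => Nat.cast_nonneg _
  linarith

/-! ### The final allocation -/

/-- After a halt every held index lies within `D + 2 e` of the number of bids: `D` from not being
outbid, one `e` from the mark and one from the count. -/
theorem heldCount_le (hR : Regular M P z e N) (h : Inv M P z e st) (hs : Settled M P z st)
    (hN : st.clock ≤ N) (j : Fin k) : (heldCount M st j : ℝ) ≤ effSupply M P + 2 * e := by
  obtain ⟨idx, hH⟩ := h.held
  obtain ⟨C, hC⟩ := h.counts.exists_nat j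
  have hacc := (abs_le.1 (h.counts.abs_count_sub_le hR.accurate hN j)).1
  have hpos : 0 ≤ effSupply M P + 2 * e := by linarith [hR.supply_pos, hR.err_nonneg]
  set m₀ := ⌊effSupply M P + 2 * e⌋₊
  have hsub : ((Finset.univ.sigma fun i => (st.bundle i).filter fun g =>
      M.kind g = j).image fun q => idx q.1 q.2) ⊆ Finset.Ico (C - m₀) C := by
    intro b hb
    simp only [Finset.mem_image, Finset.mem_sigma, Finset.mem_univ, true_and,
      Finset.mem_filter] at hb
    obtain ⟨⟨i, g⟩, ⟨hg, hk⟩, rfl⟩ := hb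
    change idx i g ∈ _
    have h1 := hs.not_outbid i g hg
    have h2 := hH.idx_lt i g hg
    have h3 := (abs_le.1 (hH.abs_mark_sub_le i g hg)).2
    rw [hk] at h1 h2
    rw [hC] at h2 hacc
    have h4 : idx i g < C := by exact_mod_cast h2
    have h5 : C - idx i g ≤ m₀ := by
      apply Nat.le_floor
      rw [Nat.cast_sub h4.le]
      linarith
    rw [Finset.mem_Ico]
    omega
  have hcard := Finset.card_le_card hsub
  rw [← heldCount_eq_card_image hH, Nat.card_Ico] at hcard
  have : heldCount M st j ≤ m₀ := by omega
  calc (heldCount M st j : ℝ) ≤ m₀ := by exact_mod_cast this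
    _ ≤ _ := Nat.floor_le hpos

theorem price_sub_incr_le_heldPrice (hR : Regular M P z e N) (h : CountInv M P z e st)
    (hs : Settled M P z st) {i : Fin n} {g : G} (hg : g ∈ st.bundle i) :
    price M P st g - P.incr ≤ heldPrice M P st i g := by
  rw [heldPrice, if_pos hg, price]
  have hD := hR.supply_pos
  have h1 := hs.not_outbid i g hg
  have h2 := h.level_le (M.kind g)
  have h3 : st.level (M.kind g) ≤ ⌊st.mark i g / effSupply M P⌋₊ + 1 := by
    rw [← Nat.sub_le_iff_le_add]
    rcases Nat.eq_zero_or_pos (st.level (M.kind g)) with h0 | h0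
    · simp [h0]
    · apply Nat.le_floor
      rw [Nat.cast_sub h0, le_div_iff₀ hD]
      push_cast
      linarith
  have h4 : (st.level (M.kind g) : ℝ) ≤ ⌊st.mark i g / effSupply M P⌋₊ + 1 := by exact_mod_cast h3
  nlinarith [hR.incr_pos]

theorem sum_price_le_of_disjoint (hR : Regular M P z e N)
    (hcard : ∀ j, (Finset.univ.filter fun g => M.kind g = j).card = M.supply)
    {S : Fin n → Finset G} (hS : ∀ i j, i ≠ j → Disjoint (S i) (S j)) :
    ∑ i, bundlePrice (price M P st) (S i) ≤ ∑ j, M.supply * (P.incr * st.level j) := by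
  have h1 : ∑ i, bundlePrice (price M P st) (S i) =
      ∑ g ∈ Finset.univ.biUnion S, price M P st g :=
    (Finset.sum_biUnion fun i _ j _ hij => hS i j hij).symm
  have h2 : ∑ g, price M P st g = ∑ j, (M.supply : ℝ) * (P.incr * st.level j) := by
    rw [← Finset.sum_fiberwise Finset.univ M.kind]
    refine Finset.sum_congr rfl fun j _ => ?_
    rw [Finset.sum_congr rfl fun g hg => by rw [price, (Finset.mem_filter.1 hg).2],
      Finset.sum_const, hcard, nsmul_eq_mul]
  rw [h1, ← h2]
  exact Finset.sum_le_sum_of_subset_of_nonneg (Finset.subset_univ _)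
    fun g _ _ => price_nonneg hR.incr_pos g

theorem welfare_le_of_settled (hR : Regular M P z e N) (h : Inv M P z e st)
    (hs : Settled M P z st) (hN : st.clock ≤ N)
    (hcard : ∀ j, (Finset.univ.filter fun g => M.kind g = j).card = M.supply)
    (hle : effSupply M P + 2 * e ≤ M.supply)
    (hge : M.supply - (effSupply M P - 2 * e - 2) ≤ P.incr * M.supply)
    {S : Fin n → Finset G} (hS : ∀ i j, i ≠ j → Disjoint (S i) (S j)) :
    M.welfare S ≤ M.welfare st.bundle + P.rho * Fintype.card G +
      2 * P.incr * (k * M.supply) := by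
  have h1 : M.welfare S ≤ M.welfare st.bundle
      - ∑ i, bundlePrice (heldPrice M P st i) (st.bundle i) + ∑ i, wants M P st i
      + ∑ i, bundlePrice (price M P st) (S i) := by
    rw [Market.welfare, Market.welfare, ← Finset.sum_sub_distrib, ← Finset.sum_add_distrib,
      ← Finset.sum_add_distrib]
    refine Finset.sum_le_sum fun i _ => ?_
    linarith [value_le_of_inv hR h i (S i)]
  have h2 : ∑ j, heldCount M st j * (P.incr * st.level j - P.incr) ≤
      ∑ i, bundlePrice (heldPrice M P st i) (st.bundle i) := by
    rw [← sum_kind_eq_heldCount]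
    exact Finset.sum_le_sum fun i _ => Finset.sum_le_sum fun g hg =>
      price_sub_incr_le_heldPrice hR h.counts hs hg
  have h3 := sum_price_le_of_disjoint (st := st) hR hcard hS
  have h4 : ∑ j, M.supply * (P.incr * st.level j) -
      ∑ j, heldCount M st j * (P.incr * st.level j - P.incr) ≤ 2 * P.incr * (k * M.supply) := by
    rw [← Finset.sum_sub_distrib]
    have hj : ∀ j ∈ (Finset.univ : Finset (Fin k)), M.supply * (P.incr * st.level j) -
        heldCount M st j * (P.incr * st.level j - P.incr) ≤ 2 * P.incr * M.supply := by
      intro j _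
      have a1 := hR.incr_pos
      have a2 : (heldCount M st j : ℝ) ≤ M.supply := (heldCount_le hR h hs hN j).trans hle
      have a3 : (0 : ℝ) ≤ M.supply := Nat.cast_nonneg _
      rcases Nat.eq_zero_or_pos (st.level j) with h0 | h0
      · rw [h0]
        push_cast
        nlinarith
      · have a4 := le_heldCount hR h hN h0
        have a5 := price_sub_incr_le_one hR h.counts hN j
        have a6 : (1 : ℝ) ≤ st.level j := by exact_mod_cast h0
        -- The loss of a type is `(p - a) (s - h) + a s`, where `h` copies are held: unsold copies
        -- at a price of at most `1 + a`, and one increment per copy.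
        have a7 : (P.incr * st.level j - P.incr) * (M.supply - heldCount M st j) ≤
            1 * (P.incr * M.supply) :=
          mul_le_mul a5 (by linarith) (by linarith) zero_le_one
        linarith
    refine (Finset.sum_le_card_nsmul _ _ _ hj).trans (le_of_eq ?_)
    simp
    ring
  linarith [hs.sum_wants_lt]

end PAlloc

end

/-! ### Assembling the guarantee -/

/-- The guarantees of the auction when the noise of the counters is small. -/
theorem palloc_guarantee {n k : ℕ} {G : Type*} [Fintype G] [DecidableEq G] {M : Market n k G}
    {P : PAllocParams} {z : Option (Fin k) → ℕ → ℝ} (hV : M.IsValid)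
    (hGS : ∀ i, GrossSubstitutes (M.val i)) (hk : 1 ≤ k) (hincr : 0 < P.incr)
    (hincr3 : P.incr ≤ 1 / 3) (hrho : P.rho = P.incr) (hE : 1 ≤ P.E n k)
    (hs : 4 * P.E n k + 1 ≤ P.incr * M.supply)
    (hz : PAlloc.Accurate z (P.E n k - 1) (n * ⌈P.T⌉₊)) (ch : PAlloc.ChoiceRule M P) :
    M.RespectsSupply (palloc M P z ch).2 ∧
      M.opt - 3 * P.incr * Fintype.card G ≤ M.welfare (palloc M P z ch).2 := by
  classical
  have hcard : ∀ j, (Finset.univ.filter fun g => M.kind g = j).card = M.supply := fun j => by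
    convert hV.card_kind j
  have hd : (Fintype.card G : ℝ) = k * M.supply := by
    have h1 := Finset.card_eq_sum_card_fiberwise (f := M.kind) (s := Finset.univ)
      (t := Finset.univ) (fun _ _ => Finset.mem_coe.2 (Finset.mem_univ _))
    simp only [hcard, Finset.sum_const, Finset.card_univ, Fintype.card_fin, smul_eq_mul] at h1
    exact_mod_cast h1
  have hD : PAlloc.effSupply M P = M.supply - (2 * P.E n k + 1) := rfl
  have hs0 : (0 : ℝ) ≤ M.supply := Nat.cast_nonneg _
  have hR : PAlloc.Regular M P z (P.E n k - 1) (n * ⌈P.T⌉₊) := by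
    refine ⟨hincr, by linarith, ?_, hz, hGS, hV.val_mem⟩
    rw [hD]
    nlinarith
  have hk' : (1 : ℝ) ≤ k := by exact_mod_cast hk
  have hsd : (M.supply : ℝ) ≤ Fintype.card G := by rw [hd]; nlinarith
  have hhalt : (PAlloc.run M P z ch ⌈P.T⌉₊).halted := by
    refine PAlloc.halted_run hR (by linarith) le_rfl ?_
    -- There are at most `(x + 1) d` bids, while `T` rounds without a halt would force a count of
    -- `10 x ^ 2 * (a d / 2) = 5 x d`. For `x ≥ 3` this exceeds `2 (x + 1) d` plus the counter
    -- error.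
    set x := 1 / P.incr with hx
    have hax : P.incr * x = 1 := by rw [hx]; field_simp
    have hx3 : 3 ≤ x := by rw [hx, le_div_iff₀ hincr]; linarith
    have hT : P.T = 10 * x ^ 2 := by
      rw [PAllocParams.T, hrho, hx]; field_simp
    set d : ℝ := ((Fintype.card G : ℕ) : ℝ)
    have had : P.incr * M.supply ≤ P.incr * d := by gcongr
    have had1 : P.incr * d ≤ 1 / 3 * d := by gcongr
    have h1 : (k : ℝ) * ((x + 1) * PAlloc.effSupply M P + (P.E n k - 1) + 1) ≤ (x + 1) * d := by
      rw [hd, hD]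
      have : (x + 1) * (M.supply - (2 * P.E n k + 1)) + (P.E n k - 1) + 1 ≤
          (x + 1) * M.supply := by nlinarith
      calc _ ≤ (k : ℝ) * ((x + 1) * M.supply) := by gcongr
        _ = _ := by ring
    have h2 : 10 * x ^ 2 * (P.incr * d / 2) ≤ ⌈P.T⌉₊ * (P.rho * d - 2 * P.E n k) := by
      rw [hrho, ← hT]
      have : 0 ≤ P.incr * d := by positivity
      exact mul_le_mul (Nat.le_ceil _) (by linarith) (by linarith) (Nat.cast_nonneg _)
    have h3 : 10 * x ^ 2 * (P.incr * d / 2) = 5 * x * d := by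
      calc _ = 5 * x * d * (P.incr * x) := by ring
        _ = _ := by rw [hax, mul_one]
    nlinarith
  have hrun := PAlloc.runInv_run (ch := ch) hR (by linarith) ⌈P.T⌉₊ le_rfl
  have hset := hrun.of_halted hhalt
  have hclock := hrun.clock_le
  have hle : PAlloc.effSupply M P + 2 * (P.E n k - 1) ≤ M.supply := by rw [hD]; linarith
  constructor
  · intro j
    have h1 : (PAlloc.heldCount M (PAlloc.run M P z ch ⌈P.T⌉₊) j : ℝ) ≤ M.supply :=
      (PAlloc.heldCount_le hR hrun.inv hset hclock j).trans hle
    have h2 : PAlloc.heldCount M (PAlloc.run M P z ch ⌈P.T⌉₊) j ≤ M.supply := by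
      exact_mod_cast h1
    rw [PAlloc.heldCount] at h2
    convert h2
    rfl
  · rw [sub_le_iff_le_add, Market.opt]
    refine csSup_le ⟨_, fun _ => ∅, fun _ _ _ => Finset.disjoint_empty_left _, rfl⟩ ?_
    rintro w ⟨S, hS, rfl⟩
    have h := PAlloc.welfare_le_of_settled hR hrun.inv hset hclock hcard hle
      (by rw [hD]; linarith) hS
    rw [hrho, ← hd] at h
    change _ ≤ M.welfare (PAlloc.run M P z ch ⌈P.T⌉₊).bundle + _
    linarith

theorem mainTheorem4 (B : ℝ) (hB : 1 < B) (hBe : B ≤ Real.exp 1) :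
    -- the supply threshold is `O (1 / (α ^ 3 ε) * polylog (n, k, 1 / α, 1 / γ))`
    (∃ c : ℕ, ∀ ε₀ : ℝ, 0 < ε₀ → ∃ C : ℝ, 0 < C ∧
      ∀ (n k : ℕ) (α γ ε : ℝ), 1 ≤ n → 1 ≤ k → 0 < α → α ≤ 1 → 0 < γ → γ ≤ 1 →
        0 < ε → ε ≤ ε₀ →
        (12 * supplyError B α γ ε n k + 3) / α ≤
          C * (1 / (α ^ 3 * ε)) *
            (1 + Real.log n + Real.log k + Real.log (1 / α) + Real.log (1 / γ)) ^ c) ∧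
    -- the welfare guarantee
    (∀ {n k : ℕ} {G : Type*} [Fintype G] [DecidableEq G] (M : Market n k G) (α γ ε : ℝ)
      {Ω : Type*} [MeasurableSpace Ω] (μ : Measure Ω) [IsProbabilityMeasure μ]
      (Z : Option (Fin k) → ℕ → Ω → ℝ),
      M.IsValid → (∀ i, GrossSubstitutes (M.val i)) →
      n ≤ Fintype.card G → 0 < α → α < (n : ℝ) / Fintype.card G → 0 < γ → 0 < ε →
      (12 * supplyError B α γ ε n k + 3) / α ≤ M.supply →
      let P : PAllocParams := ⟨α / 3, α / 3, ε, γ, B⟩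
      iIndepFun (fun q : Option (Fin k) × ℕ => Z q.1 q.2) μ →
      (∀ j t, HasLaw (Z j t) (laplace (P.noiseScale n)) μ) →
      ∃ A : Set Ω, MeasurableSet A ∧ ENNReal.ofReal (1 - γ) ≤ μ A ∧
        ∀ ω ∈ A, ∀ ch : PAlloc.ChoiceRule M P,
          let g := (palloc M P (fun j t => Z j t ω) ch).2
          M.RespectsSupply g ∧ M.opt - α * Fintype.card G ≤ M.welfare g) := by
  refine ⟨supplyError_bound_polylog hB hBe, ?_⟩
  intro n k G _ _ M α γ ε Ω _ μ _ Z hV hGS hnd hα hαn hγ hε hs P hind hlaw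
  -- For `γ ≥ 1` the empty event suffices; the union bound needs `γ < 1`.
  rcases le_or_gt 1 γ with hγ1 | hγ1
  · exact ⟨∅, MeasurableSet.empty, by rw [ENNReal.ofReal_of_nonpos (by linarith)]; exact bot_le,
      fun ω hω => absurd hω (Set.notMem_empty ω)⟩
  have hd : 0 < Fintype.card G := by
    rcases Nat.eq_zero_or_pos (Fintype.card G) with h | h
    · rw [h] at hαn
      simp at hαn
      linarith
    · exact h
  have hd' : (0 : ℝ) < Fintype.card G := by exact_mod_cast hd
  have hn : 1 ≤ n := by
    rcases Nat.eq_zero_or_pos n with rfl | h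
    · simp at hαn
      linarith
    · exact h
  have hk : 1 ≤ k := by
    obtain ⟨g⟩ := Fintype.card_pos_iff.1 hd
    exact Nat.lt_of_le_of_lt (Nat.zero_le _) (M.kind g).isLt
  have hα1 : α ≤ 1 := by
    refine hαn.le.trans ?_
    rw [div_le_one hd']
    exact_mod_cast hnd
  obtain ⟨hb, hE, hunion⟩ := noise_union_bound hB hBe hα hα1 hγ hγ1 hε hn hk
  have hPE : P.E n k = supplyError B α γ ε n k := PAllocParams.E_eq_supplyError hα hε n k
  rw [← hPE, div_le_iff₀ hα] at hs
  have hincr : P.incr = α / 3 := rfl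
  obtain ⟨A, hA, hμA, hacc⟩ := exists_accurate_event hb hE hind hlaw hunion
  refine ⟨A, hA, hμA, fun ω hω ch => ?_⟩
  have h := palloc_guarantee hV hGS hk (by rw [hincr]; positivity) (by rw [hincr]; linarith) rfl
    (by linarith [show 0 ≤ P.E n k - 1 from hE]) (by rw [hincr]; linarith) (hacc ω hω) ch
  refine ⟨h.1, ?_⟩
  have h2 := h.2
  rw [hincr, mul_div_cancel₀ _ (three_ne_zero)] at h2
  exact h2
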